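/- Let $m>1$, let $\mathbb F$ be a field (for instance $\mathbb Q$ or $\mathbb F_r$ with $r$ prime), and put $\Lambda_m=\mathbb F[\mathbb Z_m]$. Let $L$ be an $m$-periodic oriented link, presented by an $m$-periodic diagram $D$, i.e. a planar diagram preserved, as an unoriented diagram, by a rotation of order $m$ of the plane and disjoint from its centre. For $h,t\in\mathbb F$ let $C_{h,t}^{*}(D)$ be the cube-of-resolutions complex of the Frobenius algebra $A=\mathbb F[X]/(X^2-hX-t)$ with $\Delta(1)=1\otimes X+X\otimes 1-h\,1\otimes 1$, $\Delta(X)=X\otimes X+t\,1\otimes 1$. Its basis consists of the resolutions of $D$ with circles labelled by $1$ (degree $1$) or $X$ (degree $-1$). A labelled resolution with $k$ crossings $1$-smoothed has homological degree $k-n_-$ and quantum degree $\sum(\text{degrees of labels})+k+n_+-2n_-$, where $n_\pm$ are the numbers of positive and negative crossings. The group $\mathbb Z_m$ acts on this space by permuting the labelled resolutions, with the signs of the induced reordering of the $1$-smoothed crossings, and commutes with the differential. The cases $(h,t)=(0,0)$, $(0,1)$, and, in characteristic $2$, $(1,0)$ are the Khovanov, the Lee and the Bar-Natan theory. Let $M$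 be a $\Lambda_m$-module and $P_\bullet\to M$ any projective resolution. Define $EH_{h,t}^{i}(L;M)=\operatorname{Ext}^i_{\Lambda_m}(M;C^*_{h,t}(D))$ as the homology of the total complex $\bigoplus_{a+b=i}\operatorname{Hom}_{\Lambda_m}(P_a,C_{h,t}^{b}(D))$. It carries the decreasing filtration $\mathcal F^j$ by the classes of cocycles of quantum degree at least $j$. For $(h,t)=(0,0)$ the total complex is graded by the quantum degree, which gives the bigraded equivariant Khovanov homology $EKh^{i,j}(L;M)$. Write $ELee$ and $EBN$ for the filtered groups $EH_{0,1}$ and $EH_{1,0}$. 1. If $\operatorname{char}\mathbb F\neq 2$, then the differentials of the Khovanov and the Lee complex of $D$ square to zero, and there is a spectral sequence $\{E_u,d_u\}_{u\ge 1}$ of bigraded $\mathbb F$-vector spaces, with $d_u$ of bidegree $(1,4u)$ and $E_1^{i,j}\cong EKh^{i,j}(L;M)$, which converges to $ELee(L;M)$. 2. If $\operatorname{char}\mathbb F=2$, then the differentials of the Khovanov and the Bar-Natan complex of $D$ square to zero, and there is a spectral sequence $\{E_u,d_u\}_{u\ge 1}$ of bigraded $\mathbb F$-vector spaces, with $d_u$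 of bidegree $(1,2u)$ and $E_1^{i,j}\cong EKh^{i,j}(L;M)$, which converges to $EBN(L;M)$. Here convergence to $H^*$ means: in each degree $i$ the filtration of $H^i$ is exhausting and terminates at $0$ after finitely many steps, and there is an $N$ such that for all $u\ge N$ one has $d_u=0$ and $E_u^{i,j}\cong \mathcal F^jH^i/\mathcal F^{j+1}H^i$ for all $i,j$. -/

import Mathlib

open CategoryTheory

universe u v

noncomputable section

/-! ### Oriented planar link diagrams -/

/-- The four ends of strands at each of `n` crossings.  At every crossing the ends are numbered
`0, 1, 2, 3` counterclockwise; `0` and `2` belong to the lower strand, `1` and `3` to the upper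
strand. -/
abbrev StrandEnd (n : ℕ) : Type := Fin n × Fin 4

/-- The next end, counterclockwise, at the same crossing. -/
def StrandEnd.rot {n : ℕ} : Equiv.Perm (StrandEnd n) :=
  Equiv.prodCongr (Equiv.refl _) (Equiv.addRight 1)

/-- An oriented link diagram in the plane: a 4-valent planar graph with over/under information,
described by the way in which the arcs join the ends at the crossings, together with
`circles` many closed components without crossings. -/
structure LinkDiagram where
  /-- the number of crossings -/
  n : ℕ
  /-- the number of components without crossings -/
  circles : ℕ
  /-- the other end of the arc that begins at a given end -/
  arc : Equiv.Perm (StrandEnd n)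
  arc_arc : ∀ e, arc (arc e) = e
  arc_ne : ∀ e, arc e ≠ e
  /-- the orientation: `out e` holds if the strand leaves the crossing through `e` -/
  out : StrandEnd n → Bool
  out_arc : ∀ e, out (arc e) = !(out e)
  out_opposite : ∀ x i, out (x, i + 2) = !(out (x, i))
  /-- Planarity, by Euler's formula `V - E + F = 2 C` with `V = n` crossings, `E = 2 n` arcs,
  the orbits of `rot * arc` as faces, and `C` connected components of the graph. -/
  planar : Nat.card (Quotient (Equiv.Perm.SameCycle.setoid (StrandEnd.rot * arc))) =
    n + 2 * Nat.card (Quotient (Relation.EqvGen.setoid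
      (fun a b : StrandEnd n => b = arc a ∨ b = StrandEnd.rot a)))

namespace LinkDiagram

/-- A crossing is positive if the upper strand has to be turned counterclockwise, by less than
a half turn, to agree with the lower strand, orientations included. -/
def IsPositive (D : LinkDiagram) (x : Fin D.n) : Prop := D.out (x, 1) = D.out (x, 2)

instance (D : LinkDiagram) : DecidablePred D.IsPositive :=
  fun x => inferInstanceAs (Decidable (D.out (x, 1) = D.out (x, 2)))

/-- The number of positive crossings. -/
def nPos (D : LinkDiagram) : ℕ := (Finset.univ.filter fun x => D.IsPositive x).card

/-- The number of negative crossings. -/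
def nNeg (D : LinkDiagram) : ℕ := (Finset.univ.filter fun x => ¬ D.IsPositive x).card

/-- A symmetry of a diagram by a group `G`: an action on the crossings, their ends and the
components without crossings, which preserves the cyclic order at the crossings (the orientation of
the plane), the arcs, and the over/under information. -/
structure Symmetry (D : LinkDiagram) (G : Type*) [Group G] where
  onCrossing : G →* Equiv.Perm (Fin D.n)
  onEnd : G →* Equiv.Perm (StrandEnd D.n)
  onCircle : G →* Equiv.Perm (Fin D.circles)
  fst_onEnd : ∀ g e, (onEnd g e).1 = onCrossing g e.1
  onEnd_rot : ∀ g e, onEnd g (StrandEnd.rot e) = StrandEnd.rot (onEnd g e)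
  onEnd_arc : ∀ g e, onEnd g (D.arc e) = D.arc (onEnd g e)
  onEnd_under : ∀ g e, ((onEnd g e).2 = 0 ∨ (onEnd g e).2 = 2) ↔ (e.2 = 0 ∨ e.2 = 2)

/-- The structure of an `m`-periodic diagram: a symmetry by `ℤ/m`.  Since the diagram
avoids the centre of the rotation, no nontrivial rotation fixes a crossing or maps an
arc to itself.  (A component without crossings may be mapped to itself: it can go around the
centre.)  Every diagram that is invariant under the rotation of the plane by `2 π / m` and avoids
its centre has this structure. -/
structure Periodic (D : LinkDiagram) (m : ℕ) extends Symmetry D (Multiplicative (ZMod m)) where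
  crossing_free : ∀ g, g ≠ 1 → ∀ x, onCrossing g x ≠ x
  arc_free : ∀ g e, onEnd g e ≠ D.arc e

/-! ### Resolutions and the Khovanov-like complexes -/

/-- The resolution of all crossings in which the crossings in `S` get the `1`-smoothing, the others
the `0`-smoothing: the end to which a given end is joined.  The `0`-smoothing joins `0` with `1` and
`2` with `3`, the `1`-smoothing joins `0` with `3` and `1` with `2`. -/
def smooth {n : ℕ} (S : Finset (Fin n)) (e : StrandEnd n) : StrandEnd n :=
  if e.1 ∈ S then (e.1, ![3, 2, 1, 0] e.2) else (e.1, ![1, 0, 3, 2] e.2)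

/-- Two ends lie on the same circle of the resolution given by `S`. -/
def circleSetoid (D : LinkDiagram) (S : Finset (Fin D.n)) : Setoid (StrandEnd D.n) :=
  Relation.EqvGen.setoid (fun a b => b = D.arc a ∨ b = smooth S a)

/-- The circles through crossings in the resolution given by `S`.  All circles of the resolution are
these and the components without crossings. -/
abbrev Circle (D : LinkDiagram) (S : Finset (Fin D.n)) : Type := Quotient (D.circleSetoid S)

instance (D : LinkDiagram) (S : Finset (Fin D.n)) : Fintype (D.Circle S) :=
  @Fintype.ofFinite _ (Quotient.finite _)

/-- An enhanced state: a resolution `S` and a label of each of its circles by a basis vector of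
`A = F[X]/(X² - hX - t)`, where `true` stands for `1` and `false` stands for `X`.
A label of the circles is given by a function on the ends that is constant along the
circles, and a function on the components without crossings. -/
def EnhState (D : LinkDiagram) : Type :=
  {s : Finset (Fin D.n) × (StrandEnd D.n → Bool) × (Fin D.circles → Bool) //
    ∀ e, s.2.1 (D.arc e) = s.2.1 e ∧ s.2.1 (smooth s.1 e) = s.2.1 e}

namespace EnhState

variable {D : LinkDiagram}

instance : Fintype D.EnhState := by unfold EnhState; infer_instance

instance : DecidableEq D.EnhState := by unfold EnhState; infer_instance

/-- The set of crossings with `1`-smoothing. -/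
def res (s : D.EnhState) : Finset (Fin D.n) := s.1.1

/-- The label of the circle through an end. -/
def label (s : D.EnhState) : StrandEnd D.n → Bool := s.1.2.1

/-- The label of a component without crossings. -/
def free (s : D.EnhState) : Fin D.circles → Bool := s.1.2.2

theorem label_eq (s : D.EnhState) {a b : StrandEnd D.n} (h : D.circleSetoid s.res a b) :
    s.label a = s.label b := by
  induction h with
  | rel a b h =>
    rcases h with h | h
    · rw [h]; exact (s.2 a).1.symm
    · rw [h]; exact (s.2 a).2.symm
  | refl => rfl
  | symm _ _ _ ih => exact ih.symm
  | trans _ _ _ _ _ ih1 ih2 => exact ih1.trans ih2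

/-- The label as a function on the circles. -/
def circleLabel (s : D.EnhState) : D.Circle s.res → Bool :=
  Quotient.lift s.label fun _ _ h => s.label_eq h

/-- The degree of a basis vector of `A`: `deg 1 = 1` and `deg X = -1`. -/
def labelDeg (b : Bool) : ℤ := if b then 1 else -1

/-- The homological grading. -/
def hdeg (s : D.EnhState) : ℤ := s.res.card - D.nNeg

/-- The quantum grading. -/
def qdeg (s : D.EnhState) : ℤ :=
  ∑ c, labelDeg (s.circleLabel c) + ∑ c, labelDeg (s.free c) + s.res.card + D.nPos - 2 * D.nNeg

end EnhState

section Frobenius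

variable {F : Type*} [Field F]

/-- The coefficient of the basis vector `c` in the product of the basis vectors `a`, `b` of
`A = F[X]/(X² - hX - t)`. -/
def mulCoeff (h t : F) : Bool → Bool → Bool → F
  | true, true, true => 1
  | true, true, false => 0
  | true, false, true => 0
  | true, false, false => 1
  | false, true, true => 0
  | false, true, false => 1
  | false, false, true => t
  | false, false, false => h

/-- The coefficient of `b ⊗ c` in `Δ a`, where `Δ 1 = 1 ⊗ X + X ⊗ 1 - h 1 ⊗ 1` and
`Δ X = X ⊗ X + t 1 ⊗ 1`. -/
def comulCoeff (h t : F) : Bool → Bool → Bool → F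
  | true, true, true => -h
  | true, true, false => 1
  | true, false, true => 1
  | true, false, false => 0
  | false, true, true => t
  | false, true, false => 0
  | false, false, true => 0
  | false, false, false => 1

open scoped Classical in
/-- The matrix coefficient from `s` to `s'` of the map of the saddle at the crossing `x`, where
`s'.res = insert x s.res`.  The circles away from `x` keep their labels.  If there are two circles
at `x` before the saddle and one after it, they are merged by the product; if there is one before
and two after it, it is split by the coproduct.  In a planar diagram one of the two occurs. -/
def saddleCoeff (D : LinkDiagram) (h t : F) (x : Fin D.n) (s s' : D.EnhState) : F :=
  if (∀ e, ¬ D.circleSetoid s.res e (x, 0) → ¬ D.circleSetoid s.res e (x, 2) →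
        s'.label e = s.label e) ∧ s'.free = s.free then
    if ¬ D.circleSetoid s.res (x, 0) (x, 2) ∧ D.circleSetoid s'.res (x, 0) (x, 2) then
      mulCoeff h t (s.label (x, 0)) (s.label (x, 2)) (s'.label (x, 0))
    else if D.circleSetoid s.res (x, 0) (x, 2) ∧ ¬ D.circleSetoid s'.res (x, 0) (x, 2) then
      comulCoeff h t (s.label (x, 0)) (s'.label (x, 0)) (s'.label (x, 2))
    else 0
  else 0

/-- The matrix coefficient from `s` to `s'` of the differential of the cube of resolutions. -/
def diffCoeff (D : LinkDiagram) (h t : F) (s s' : D.EnhState) : F :=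
  ∑ x, if x ∉ s.res ∧ s'.res = insert x s.res then
    (-1) ^ (s.res.filter fun y => y < x).card * D.saddleCoeff h t x s s' else 0

/-- The differential of the Khovanov-like complex of the Frobenius system
with parameters `h` and `t`, as an `F`-linear map. -/
def diff (D : LinkDiagram) (h t : F) : (D.EnhState → F) →ₗ[F] (D.EnhState → F) where
  toFun φ s' := ∑ s, D.diffCoeff h t s s' * φ s
  map_add' φ ψ := by funext s'; simp [mul_add, Finset.sum_add_distrib]
  map_smul' a φ := by
    funext s'
    simp only [Pi.smul_apply, smul_eq_mul, RingHom.id_apply, Finset.mul_sum]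
    exact Finset.sum_congr rfl fun _ _ => by ring

end Frobenius

/-! ### The action of the symmetries on the complex -/

theorem ite_eq_ite {α : Type*} {p q : Prop} {ip : Decidable p} {iq : Decidable q} {a b c d : α}
    (h : p ↔ q) (hab : q → a = b) (hcd : c = d) : (if p then a else c) = if q then b else d := by
  subst hcd
  by_cases hq : q
  · rw [if_pos hq, if_pos (h.2 hq), hab hq]
  · rw [if_neg hq, if_neg (fun H => hq (h.1 H))]

namespace Symmetry

variable {D : LinkDiagram} {G : Type*} [Group G] (σ : D.Symmetry G)

theorem onEnd_mk (g : G) (x : Fin D.n) :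
    (∀ i, σ.onEnd g (x, i) = (σ.onCrossing g x, i)) ∨
      (∀ i, σ.onEnd g (x, i) = (σ.onCrossing g x, i + 2)) := by
  have key : ∀ i : Fin 4, σ.onEnd g (x, i + 1) =
      ((σ.onEnd g (x, i)).1, (σ.onEnd g (x, i)).2 + 1) := fun i => σ.onEnd_rot g (x, i)
  have h0 : (σ.onEnd g (x, 0)).2 = 0 ∨ (σ.onEnd g (x, 0)).2 = 2 :=
    (σ.onEnd_under g (x, 0)).2 (Or.inl rfl)
  have hx := σ.fst_onEnd g (x, 0)
  obtain ⟨c, hc⟩ : ∃ c, σ.onEnd g (x, 0) = (σ.onCrossing g x, c) :=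
    ⟨_, Prod.ext hx rfl⟩
  rw [hc] at h0
  have k0 := key 0
  have k1 := key 1
  have k2 := key 2
  simp only [hc, Fin.isValue, zero_add] at k0
  simp only [k0, Fin.isValue, Fin.reduceAdd] at k1
  simp only [k1, Fin.isValue, Fin.reduceAdd] at k2
  rcases h0 with h0 | h0 <;> simp only [Fin.isValue] at h0 <;> subst h0
  · left; intro i; fin_cases i <;> simp_all
  · right; intro i; fin_cases i <;> simp_all

/-- The image of a set of crossings. -/
def onRes (g : G) (S : Finset (Fin D.n)) : Finset (Fin D.n) :=
  S.map (σ.onCrossing g).toEmbedding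

theorem mem_onRes (g : G) (S : Finset (Fin D.n)) (x : Fin D.n) :
    σ.onCrossing g x ∈ σ.onRes g S ↔ x ∈ S := by
  simp [onRes]

theorem onRes_one (S : Finset (Fin D.n)) : σ.onRes 1 S = S := by
  simp only [onRes, map_one]; exact Finset.map_refl

theorem onRes_mul (g h : G) (S : Finset (Fin D.n)) :
    σ.onRes (g * h) S = σ.onRes g (σ.onRes h S) := by
  simp only [onRes, map_mul, Finset.map_map]; rfl

theorem onEnd_smooth (g : G) (S : Finset (Fin D.n)) (e : StrandEnd D.n) :
    σ.onEnd g (smooth S e) = smooth (σ.onRes g S) (σ.onEnd g e) := by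
  obtain ⟨x, i⟩ := e
  rcases σ.onEnd_mk g x with H | H
  all_goals
    by_cases hx : x ∈ S <;> simp only [smooth, hx, H, σ.mem_onRes, if_true, if_false] <;>
      fin_cases i <;> rfl

theorem circle_map (g : G) (S : Finset (Fin D.n)) {a b : StrandEnd D.n}
    (h : D.circleSetoid S a b) :
    D.circleSetoid (σ.onRes g S) (σ.onEnd g a) (σ.onEnd g b) := by
  induction h with
  | rel a b h =>
    refine Relation.EqvGen.rel _ _ ?_
    rcases h with h | h
    · left; rw [h, σ.onEnd_arc]
    · right; rw [h, σ.onEnd_smooth]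
  | refl => exact Relation.EqvGen.refl _
  | symm _ _ _ ih => exact Relation.EqvGen.symm _ _ ih
  | trans _ _ _ _ _ ih1 ih2 => exact Relation.EqvGen.trans _ _ _ ih1 ih2

theorem onEnd_inv_apply (g : G) (e : StrandEnd D.n) : σ.onEnd g⁻¹ (σ.onEnd g e) = e := by
  rw [← Equiv.Perm.mul_apply, ← map_mul, inv_mul_cancel, map_one, Equiv.Perm.one_apply]

theorem onEnd_apply_inv (g : G) (e : StrandEnd D.n) : σ.onEnd g (σ.onEnd g⁻¹ e) = e := by
  rw [← Equiv.Perm.mul_apply, ← map_mul, mul_inv_cancel, map_one, Equiv.Perm.one_apply]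

theorem circle_iff (g : G) (S : Finset (Fin D.n)) (a b : StrandEnd D.n) :
    D.circleSetoid (σ.onRes g S) (σ.onEnd g a) (σ.onEnd g b) ↔ D.circleSetoid S a b := by
  refine ⟨fun h => ?_, σ.circle_map g S⟩
  have := σ.circle_map g⁻¹ _ h
  rwa [← σ.onRes_mul, inv_mul_cancel, σ.onRes_one, σ.onEnd_inv_apply, σ.onEnd_inv_apply] at this

/-- The action on enhanced states. -/
def onState (g : G) (s : D.EnhState) : D.EnhState :=
  ⟨(σ.onRes g s.res, fun e => s.label (σ.onEnd g⁻¹ e), fun c => s.free (σ.onCircle g⁻¹ c)), by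
    intro e
    obtain ⟨e, rfl⟩ := (σ.onEnd g).surjective e
    refine ⟨?_, ?_⟩
    · dsimp only
      rw [← σ.onEnd_arc, σ.onEnd_inv_apply, σ.onEnd_inv_apply]
      exact (s.2 e).1
    · dsimp only
      rw [← σ.onEnd_smooth, σ.onEnd_inv_apply, σ.onEnd_inv_apply]
      exact (s.2 e).2⟩

theorem res_onState (g : G) (s : D.EnhState) : (σ.onState g s).res = σ.onRes g s.res := rfl

theorem label_onState (g : G) (s : D.EnhState) (e : StrandEnd D.n) :
    (σ.onState g s).label (σ.onEnd g e) = s.label e :=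
  congrArg s.label (σ.onEnd_inv_apply g e)

theorem circle_res_iff (g : G) (s : D.EnhState) (a b : StrandEnd D.n) :
    D.circleSetoid (σ.onState g s).res (σ.onEnd g a) (σ.onEnd g b) ↔ D.circleSetoid s.res a b :=
  σ.circle_iff g s.res a b

theorem onState_one (s : D.EnhState) : σ.onState 1 s = s := by
  refine Subtype.ext (Prod.ext (σ.onRes_one _) (Prod.ext ?_ ?_))
  · funext e; simp [onState, EnhState.label]
  · funext e; simp [onState, EnhState.free]

theorem onState_mul (g h : G) (s : D.EnhState) :
    σ.onState (g * h) s = σ.onState g (σ.onState h s) := by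
  refine Subtype.ext (Prod.ext (σ.onRes_mul _ _ _) (Prod.ext ?_ ?_))
  · funext e; simp [onState, EnhState.label]
  · funext e; simp [onState, EnhState.free]

/-- The sign of the reordering of the crossings in `S` by `g`: `-1` to the number of pairs of
crossings in `S` whose order is reversed by `g`.  It is the sign with which `g` maps the exterior
product of the crossings in `S` to the exterior product of the crossings in `g S`. -/
def sign (g : G) (S : Finset (Fin D.n)) : ℤ :=
  ∏ x ∈ S, ∏ y ∈ S, if x < y ∧ σ.onCrossing g y < σ.onCrossing g x then -1 else 1

theorem sign_insert (g : G) {S : Finset (Fin D.n)} {x : Fin D.n} (hx : x ∉ S) :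
    σ.sign g (insert x S) =
      (∏ y ∈ S, if (x < y ↔ σ.onCrossing g x < σ.onCrossing g y) then 1 else -1) *
        σ.sign g S := by
  unfold sign
  rw [Finset.prod_insert hx, Finset.prod_insert hx]
  simp only [Finset.prod_insert hx, Finset.prod_mul_distrib, lt_irrefl, false_and, if_false,
    one_mul]
  rw [← mul_assoc, ← Finset.prod_mul_distrib]
  congr 1
  refine Finset.prod_congr rfl fun y hy => ?_
  have hxy : x ≠ y := fun h => hx (h ▸ hy)
  have hxy' : σ.onCrossing g x ≠ σ.onCrossing g y := fun h => hxy ((σ.onCrossing g).injective h)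
  rcases lt_or_gt_of_ne hxy with h | h <;> rcases lt_or_gt_of_ne hxy' with h' | h' <;>
    simp [h, h', h.not_gt, h'.not_gt]

theorem sign_one (S : Finset (Fin D.n)) : σ.sign 1 S = 1 := by
  unfold sign
  refine Finset.prod_eq_one fun x _ => Finset.prod_eq_one fun y _ => ?_
  rw [if_neg]
  rintro ⟨h1, h2⟩
  rw [map_one] at h2
  exact lt_asymm h1 h2

theorem onRes_insert (g : G) (S : Finset (Fin D.n)) (x : Fin D.n) :
    σ.onRes g (insert x S) = insert (σ.onCrossing g x) (σ.onRes g S) := by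
  simp [onRes, Finset.map_insert]

theorem sign_mul (g h : G) (S : Finset (Fin D.n)) :
    σ.sign (g * h) S = σ.sign g (σ.onRes h S) * σ.sign h S := by
  induction S using Finset.induction_on with
  | empty => simp [sign, onRes]
  | insert x S hx ih =>
    have hx' : σ.onCrossing h x ∉ σ.onRes h S := by rwa [σ.mem_onRes]
    rw [σ.onRes_insert, σ.sign_insert _ hx, σ.sign_insert _ hx, σ.sign_insert _ hx', ih]
    have : (∏ y ∈ S, if (x < y ↔ σ.onCrossing (g * h) x < σ.onCrossing (g * h) y)
          then (1 : ℤ) else -1) =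
        (∏ y ∈ σ.onRes h S, if (σ.onCrossing h x < y ↔
            σ.onCrossing g (σ.onCrossing h x) < σ.onCrossing g y) then (1 : ℤ) else -1) *
          ∏ y ∈ S, if (x < y ↔ σ.onCrossing h x < σ.onCrossing h y) then (1 : ℤ) else -1 := by
      rw [onRes, Finset.prod_map, ← Finset.prod_mul_distrib]
      refine Finset.prod_congr rfl fun y _ => ?_
      simp only [map_mul, Equiv.Perm.mul_apply, Equiv.coe_toEmbedding]
      split_ifs <;> first | rfl | tauto
    rw [this]
    ring

theorem sign_insert_mul (g : G) {S : Finset (Fin D.n)} {x : Fin D.n} (hx : x ∉ S) :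
    σ.sign g (insert x S) * (-1) ^ (S.filter fun y => y < x).card =
      (-1) ^ ((σ.onRes g S).filter fun y => y < σ.onCrossing g x).card * σ.sign g S := by
  have key : ∀ (T : Finset (Fin D.n)) (z : Fin D.n),
      (-1 : ℤ) ^ (T.filter fun y => y < z).card = ∏ y ∈ T, if y < z then -1 else 1 := by
    intro T z
    rw [Finset.prod_ite]
    simp
  rw [σ.sign_insert g hx, key, key, onRes, Finset.prod_map, mul_right_comm,
    ← Finset.prod_mul_distrib]
  congr 1
  refine Finset.prod_congr rfl fun y hy => ?_
  have hxy : x ≠ y := fun h => hx (h ▸ hy)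
  have hxy' : σ.onCrossing g x ≠ σ.onCrossing g y := fun h => hxy ((σ.onCrossing g).injective h)
  rcases lt_or_gt_of_ne hxy with h | h <;> rcases lt_or_gt_of_ne hxy' with h' | h' <;>
    simp [h, h', h.not_gt, h'.not_gt]

section Rep

variable (F : Type*) [Field F]

/-- The signed permutation action of the symmetries on the space of the Khovanov-like complexes:
`g` maps the basis vector `s` to `sign g s.res` times the basis vector `g s`. -/
def rep : Representation F G (D.EnhState → F) where
  toFun g :=
    { toFun := fun φ s =>
        (σ.sign g (σ.onState g⁻¹ s).res : F) * φ (σ.onState g⁻¹ s)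
      map_add' := fun φ ψ => by funext s; simp [mul_add]
      map_smul' := fun a φ => by
        funext s
        simp only [Pi.smul_apply, smul_eq_mul, RingHom.id_apply]
        ring }
  map_one' := by
    refine LinearMap.ext fun φ => funext fun s => ?_
    simp [σ.onState_one, σ.sign_one]
  map_mul' g h := by
    refine LinearMap.ext fun φ => funext fun s => ?_
    simp only [LinearMap.coe_mk, AddHom.coe_mk, Module.End.mul_apply]
    rw [σ.sign_mul, mul_inv_rev, σ.onState_mul, ← σ.res_onState, ← σ.onState_mul h h⁻¹,
      mul_inv_cancel, σ.onState_one]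
    push_cast
    ring

theorem rep_apply (g : G) (φ : D.EnhState → F) (s : D.EnhState) :
    σ.rep F g φ (σ.onState g s) = (σ.sign g s.res : F) * φ s := by
  change (σ.sign g (σ.onState g⁻¹ (σ.onState g s)).res : F) *
    φ (σ.onState g⁻¹ (σ.onState g s)) = _
  rw [← σ.onState_mul, inv_mul_cancel, σ.onState_one]

variable {F}

theorem mulCoeff_comm (h t : F) (a b c : Bool) : mulCoeff h t a b c = mulCoeff h t b a c := by
  cases a <;> cases b <;> cases c <;> rfl

theorem comulCoeff_comm (h t : F) (a b c : Bool) :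
    comulCoeff h t a b c = comulCoeff h t a c b := by
  cases a <;> cases b <;> cases c <;> rfl

theorem saddleCoeff_onState (g : G) (h t : F) (x : Fin D.n) (s s' : D.EnhState) :
    D.saddleCoeff h t (σ.onCrossing g x) (σ.onState g s) (σ.onState g s') =
      D.saddleCoeff h t x s s' := by
  have hfree : ((σ.onState g s').free = (σ.onState g s).free) ↔ s'.free = s.free := by
    constructor
    · intro H
      funext c
      have := congrFun H (σ.onCircle g c)
      simpa [onState, EnhState.free] using this
    · intro H
      funext c
      simp [onState, EnhState.free] at H ⊢
      rw [H]
  have hends : (σ.onEnd g (x, 0) = (σ.onCrossing g x, 0) ∧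
      σ.onEnd g (x, 2) = (σ.onCrossing g x, 2)) ∨ (σ.onEnd g (x, 0) = (σ.onCrossing g x, 2) ∧
      σ.onEnd g (x, 2) = (σ.onCrossing g x, 0)) := by
    rcases σ.onEnd_mk g x with H | H
    · exact Or.inl ⟨H 0, H 2⟩
    · exact Or.inr ⟨H 0, H 2⟩
  have hall : ∀ a b : StrandEnd D.n,
      (∀ e, ¬ D.circleSetoid (σ.onState g s).res e (σ.onEnd g a) →
        ¬ D.circleSetoid (σ.onState g s).res e (σ.onEnd g b) →
        (σ.onState g s').label e = (σ.onState g s).label e) ↔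
      (∀ e, ¬ D.circleSetoid s.res e a → ¬ D.circleSetoid s.res e b →
        s'.label e = s.label e) := by
    intro a b
    rw [(σ.onEnd g).surjective.forall]
    simp only [σ.label_onState, σ.circle_res_iff]
  have hsym : ∀ (S : Finset (Fin D.n)) (a b : StrandEnd D.n),
      D.circleSetoid S a b ↔ D.circleSetoid S b a := fun S a b =>
    ⟨fun H => (D.circleSetoid S).symm H, fun H => (D.circleSetoid S).symm H⟩
  unfold saddleCoeff
  rcases hends with ⟨h0, h2⟩ | ⟨h0, h2⟩
  · rw [← h0, ← h2]
    simp only [σ.label_onState]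
    refine ite_eq_ite (and_congr (hall _ _) hfree) (fun _ => ?_) rfl
    refine ite_eq_ite (and_congr (not_congr (σ.circle_res_iff ..)) (σ.circle_res_iff ..))
      (fun _ => rfl) ?_
    exact ite_eq_ite (and_congr (σ.circle_res_iff ..) (not_congr (σ.circle_res_iff ..)))
      (fun _ => rfl) rfl
  · rw [← h0, ← h2]
    have hswap : (∀ e, ¬ D.circleSetoid (σ.onState g s).res e (σ.onEnd g (x, 2)) →
        ¬ D.circleSetoid (σ.onState g s).res e (σ.onEnd g (x, 0)) →
        (σ.onState g s').label e = (σ.onState g s).label e) ↔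
      (∀ e, ¬ D.circleSetoid s.res e (x, 0) → ¬ D.circleSetoid s.res e (x, 2) →
        s'.label e = s.label e) := by
      rw [hall]
      exact forall_congr' fun e => ⟨fun H a b => H b a, fun H a b => H b a⟩
    have hs : ∀ r : D.EnhState, D.circleSetoid (σ.onState g r).res (σ.onEnd g (x, 2))
        (σ.onEnd g (x, 0)) ↔ D.circleSetoid r.res (x, 0) (x, 2) := fun r =>
      (σ.circle_res_iff g r _ _).trans (hsym _ _ _)
    simp only [σ.label_onState]
    refine ite_eq_ite (and_congr hswap hfree) (fun _ => ?_) rfl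
    refine ite_eq_ite (and_congr (not_congr (hs s)) (hs s')) (fun h3 => ?_) ?_
    · rw [mulCoeff_comm, s'.label_eq h3.2]
    · refine ite_eq_ite (and_congr (hs s) (not_congr (hs s'))) (fun h4 => ?_) rfl
      rw [comulCoeff_comm, s.label_eq h4.1]

theorem diffCoeff_onState (g : G) (h t : F) (s s' : D.EnhState) :
    (σ.sign g s'.res : F) * D.diffCoeff h t s s' =
      D.diffCoeff h t (σ.onState g s) (σ.onState g s') * (σ.sign g s.res : F) := by
  unfold diffCoeff
  rw [Finset.mul_sum, Finset.sum_mul]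
  refine Fintype.sum_equiv (σ.onCrossing g) _ _ fun x => ?_
  have hcond : (σ.onCrossing g x ∉ (σ.onState g s).res ∧
      (σ.onState g s').res = insert (σ.onCrossing g x) (σ.onState g s).res) ↔
      (x ∉ s.res ∧ s'.res = insert x s.res) := by
    rw [σ.res_onState, σ.res_onState, σ.mem_onRes, ← σ.onRes_insert]
    exact and_congr_right fun _ => (Finset.map_injective _).eq_iff
  by_cases hc : x ∉ s.res ∧ s'.res = insert x s.res
  · rw [if_pos hc, if_pos (hcond.2 hc), σ.saddleCoeff_onState, hc.2]
    have := congrArg (Int.cast : ℤ → F) (σ.sign_insert_mul g hc.1)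
    push_cast at this
    rw [σ.res_onState, ← mul_assoc, this]
    ring
  · rw [if_neg hc, if_neg (fun H => hc (hcond.1 H))]
    simp

/-- The action on enhanced states as a permutation. -/
def statePerm (g : G) : Equiv.Perm D.EnhState where
  toFun := σ.onState g
  invFun := σ.onState g⁻¹
  left_inv s := by rw [← σ.onState_mul, inv_mul_cancel, σ.onState_one]
  right_inv s := by rw [← σ.onState_mul, mul_inv_cancel, σ.onState_one]

theorem diff_rep (g : G) (h t : F) (φ : D.EnhState → F) :
    D.diff h t (σ.rep F g φ) = σ.rep F g (D.diff h t φ) := by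
  funext s'
  obtain ⟨s', rfl⟩ := (σ.statePerm g).surjective s'
  change ∑ s, D.diffCoeff h t s (σ.onState g s') * σ.rep F g φ s =
    σ.rep F g (D.diff h t φ) (σ.onState g s')
  rw [σ.rep_apply]
  change _ = _ * ∑ s, D.diffCoeff h t s s' * φ s
  rw [Finset.mul_sum]
  refine (Fintype.sum_equiv (σ.statePerm g) _ _ fun s => Eq.symm ?_).symm
  change D.diffCoeff h t (σ.onState g s) (σ.onState g s') * σ.rep F g φ (σ.onState g s) = _
  rw [σ.rep_apply, ← mul_assoc, ← mul_assoc, σ.diffCoeff_onState]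

variable (F) in
/-- The underlying space of the Khovanov-like complexes over `F`, on which `F[G]` acts through the
signed permutations of the enhanced states. -/
def CK (_ : D.Symmetry G) : Type _ := D.EnhState → F

instance : AddCommGroup (σ.CK F) := inferInstanceAs (AddCommGroup (D.EnhState → F))

instance : Module F (σ.CK F) := inferInstanceAs (Module F (D.EnhState → F))

/-- The coefficients of an element of the complex at the enhanced states. -/
def coeff : σ.CK F ≃ₗ[F] (D.EnhState → F) := LinearEquiv.refl F (D.EnhState → F)

instance : Module (MonoidAlgebra F G) (σ.CK F) :=
  inferInstanceAs (Module (MonoidAlgebra F G) (σ.rep F).asModule)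

theorem coeff_smul (r : MonoidAlgebra F G) (φ : σ.CK F) :
    σ.coeff (r • φ) = (σ.rep F).asAlgebraHom r (σ.coeff φ) := rfl

instance : SMulCommClass (MonoidAlgebra F G) F (σ.CK F) where
  smul_comm r a φ := by
    apply σ.coeff.injective
    simp only [coeff_smul, map_smul]

instance : IsScalarTower F (MonoidAlgebra F G) (σ.CK F) where
  smul_assoc a r φ := by
    apply σ.coeff.injective
    simp only [coeff_smul, map_smul, LinearMap.smul_apply]

/-- The differential of the Khovanov-like complex, as an `F[G]`-linear map. -/
def diffCK (h t : F) : σ.CK F →ₗ[MonoidAlgebra F G] σ.CK F :=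
  MonoidAlgebra.equivariantOfLinearOfComm
    (σ.coeff.symm.toLinearMap ∘ₗ D.diff h t ∘ₗ σ.coeff.toLinearMap)
    (fun g v => by
      apply σ.coeff.injective
      simp only [LinearMap.comp_apply, LinearEquiv.coe_coe, coeff_smul,
        LinearEquiv.apply_symm_apply, Representation.asAlgebraHom_single, one_smul]
      exact σ.diff_rep g h t _)

theorem coeff_diffCK (h t : F) (φ : σ.CK F) :
    σ.coeff (σ.diffCK h t φ) = D.diff h t (σ.coeff φ) := rfl

end Rep

/-! ### Equivariant homology -/

section Equivariant

variable {F : Type u} [Field F] {M : ModuleCat.{v} (MonoidAlgebra F G)}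
  (P : ProjectiveResolution M)

/-- The product of the spaces `Hom (P a, CK)` over all `a`.  The complex of a periodic diagram
is bounded, so that its part of total degree `i` is `⨁ a + b = i, Hom (P a, CK ^ b)`. -/
def Total : Type (max u v) := ∀ a : ℕ, P.complex.X a →ₗ[MonoidAlgebra F G] σ.CK F

instance : AddCommGroup (σ.Total P) :=
  inferInstanceAs (AddCommGroup (∀ a : ℕ, P.complex.X a →ₗ[MonoidAlgebra F G] σ.CK F))

instance : Module F (σ.Total P) :=
  inferInstanceAs (Module F (∀ a : ℕ, P.complex.X a →ₗ[MonoidAlgebra F G] σ.CK F))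

/-- The component of an element of the total complex in `Hom (P a, CK)`. -/
def component (a : ℕ) : σ.Total P →ₗ[F] (P.complex.X a →ₗ[MonoidAlgebra F G] σ.CK F) :=
  LinearMap.proj a

/-- The differential of the total complex, induced by the differential of the Khovanov-like complex
with parameters `h`, `t` and by that of the resolution; the sign makes the two anticommute. -/
def totalDiff (h t : F) : σ.Total P →ₗ[F] σ.Total P where
  toFun f a := (-1 : F) ^ a • (σ.diffCK h t ∘ₗ σ.component P a f) +
    match a with
    | 0 => 0
    | b + 1 => σ.component P b f ∘ₗ (P.complex.d (b + 1) b).hom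
  map_add' f f' := by
    refine funext fun a => LinearMap.ext fun p => ?_
    cases a with
    | zero =>
      change (-1 : F) ^ 0 • σ.diffCK h t (σ.component P 0 (f + f') p) + 0 =
        ((-1 : F) ^ 0 • σ.diffCK h t (σ.component P 0 f p) + 0) +
          ((-1 : F) ^ 0 • σ.diffCK h t (σ.component P 0 f' p) + 0)
      simp
    | succ b =>
      change (-1 : F) ^ (b + 1) • σ.diffCK h t (σ.component P (b + 1) (f + f') p) +
          σ.component P b (f + f') ((P.complex.d (b + 1) b).hom p) =
        ((-1 : F) ^ (b + 1) • σ.diffCK h t (σ.component P (b + 1) f p) +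
          σ.component P b f ((P.complex.d (b + 1) b).hom p)) +
        ((-1 : F) ^ (b + 1) • σ.diffCK h t (σ.component P (b + 1) f' p) +
          σ.component P b f' ((P.complex.d (b + 1) b).hom p))
      simp only [map_add, LinearMap.add_apply, smul_add]
      exact add_add_add_comm _ _ _ _
  map_smul' c f := by
    refine funext fun a => LinearMap.ext fun p => ?_
    have hlin : ∀ φ : σ.CK F, σ.diffCK h t (c • φ) = c • σ.diffCK h t φ := fun φ =>
      LinearMap.map_smul_of_tower _ c φ
    cases a with
    | zero =>
      change (-1 : F) ^ 0 • σ.diffCK h t (σ.component P 0 (c • f) p) + 0 =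
        c • ((-1 : F) ^ 0 • σ.diffCK h t (σ.component P 0 f p) + 0)
      simp [hlin]
    | succ b =>
      change (-1 : F) ^ (b + 1) • σ.diffCK h t (σ.component P (b + 1) (c • f) p) +
          σ.component P b (c • f) ((P.complex.d (b + 1) b).hom p) =
        c • ((-1 : F) ^ (b + 1) • σ.diffCK h t (σ.component P (b + 1) f p) +
          σ.component P b f ((P.complex.d (b + 1) b).hom p))
      simp only [map_smul, LinearMap.smul_apply, smul_add, hlin]
      rw [smul_comm c]

/-- The elements of total homological degree `i` and of quantum degree in `J`: the families of
maps `P a → CK` with values in homological degree `i - a` and in the quantum degrees in `J`. -/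
def totalPart (i : ℤ) (J : Set ℤ) : Submodule F (σ.Total P) where
  carrier := {f | ∀ a p s, σ.coeff (σ.component P a f p) s ≠ 0 →
    s.hdeg + a = i ∧ s.qdeg ∈ J}
  zero_mem' := fun a p s hs => absurd (by simp) hs
  add_mem' := by
    intro f f' hf hf' a p s hs
    by_cases h0 : σ.coeff (σ.component P a f p) s = 0
    · exact hf' a p s fun h0' => hs (by simp [h0, h0'])
    · exact hf a p s h0
  smul_mem' := by
    intro c f hf a p s hs
    exact hf a p s fun h0 => hs (by simp [h0])

/-- The cocycles among the elements of homological degree `i` and quantum degree in `J`. -/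
abbrev cocycles (h t : F) (i : ℤ) (J : Set ℤ) : Submodule F (σ.Total P) :=
  LinearMap.ker (σ.totalDiff P h t) ⊓ σ.totalPart P i J

/-- The homology of the part of the total complex of quantum degree in `J`. -/
abbrev homology (h t : F) (i : ℤ) (J : Set ℤ) : Type (max u v) :=
  σ.cocycles P h t i J ⧸
    ((σ.totalPart P (i - 1) J).map (σ.totalDiff P h t)).submoduleOf (σ.cocycles P h t i J)

/-- The bigraded equivariant Khovanov homology. -/
abbrev EKh (i j : ℤ) : Type (max u v) := σ.homology P (0 : F) 0 i {j}

/-- The equivariant homology `Ext^i (M, CK)` of the Khovanov-like theory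
with parameters `h`, `t`. -/
abbrev EK (h t : F) (i : ℤ) : Type (max u v) := σ.homology P h t i Set.univ

/-- The quantum filtration of the equivariant homology: the classes of the cocycles of
quantum degree at least `j`. -/
def filtration (h t : F) (i j : ℤ) : Submodule F (σ.EK P h t i) :=
  ((σ.totalPart P i (Set.Ici j)).submoduleOf (σ.cocycles P h t i Set.univ)).map
    (Submodule.mkQ _)

end Equivariant

end Symmetry

end LinkDiagram

/-! ### Spectral sequences -/

section SpectralSequences

universe w

/-- Spectral sequences of `F`-vector spaces with bigraded pages `E_1, E_2, …` and with
differentials of bidegree `(1, c * u)` on the page `E_u`. -/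
abbrev BigradedSS (F : Type*) [Field F] (c : ℤ) : Type _ :=
  SpectralSequence (ModuleCat.{w} F) (fun u : ℤ => ComplexShape.up' ((1, c * u) : ℤ × ℤ)) 1

/-- A bigraded spectral sequence converges to the graded vector space `H` with the
decreasing filtrations `Fil i` of `H i`: the filtrations are finite, the differentials vanish
from some page on, and from there on the page is the associated graded of `H`. -/
def BigradedSS.ConvergesTo {F : Type*} [Field F] {c : ℤ} (E : BigradedSS.{w} F c)
    (H : ℤ → Type w) [∀ i, AddCommGroup (H i)] [∀ i, Module F (H i)]
    (Fil : ∀ i, ℤ → Submodule F (H i)) : Prop :=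
  (∀ i, Antitone (Fil i)) ∧ (∀ i, ∃ j, Fil i j = ⊤) ∧ (∀ i, ∃ j, Fil i j = ⊥) ∧
  ∃ N : ℤ, ∀ (u : ℤ) (hu : 1 ≤ u), N ≤ u →
    (∀ p q, (E.page u hu).d p q = 0) ∧
    ∀ i j, Nonempty ((E.page u hu).X (i, j) ≃ₗ[F]
      (Fil i j ⧸ (Fil i (j + 1)).submoduleOf (Fil i j)))

end SpectralSequences

end

noncomputable section

namespace LinkDiagram

/-! ### Checkerboard colourings of planar diagrams -/

section Checkerboard

variable (D : LinkDiagram)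

/-- The setoid of the faces of the diagram. -/
abbrev faceSetoid : Setoid (StrandEnd D.n) :=
  Equiv.Perm.SameCycle.setoid (StrandEnd.rot * D.arc)

/-- The setoid of the connected components of the diagram. -/
abbrev componentSetoid : Setoid (StrandEnd D.n) :=
  Relation.EqvGen.setoid (fun a b : StrandEnd D.n => b = D.arc a ∨ b = StrandEnd.rot a)

/-- The functions on the ends that are constant on the components. -/
def componentFun : (Quotient D.componentSetoid → ZMod 2) →ₗ[ZMod 2] (StrandEnd D.n → ZMod 2) :=
  LinearMap.funLeft _ _ (Quotient.mk _)

theorem mem_range_componentFun {f : StrandEnd D.n → ZMod 2} (h1 : ∀ e, f (D.arc e) = f e)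
    (h2 : ∀ e, f (StrandEnd.rot e) = f e) : f ∈ LinearMap.range D.componentFun := by
  refine ⟨Quotient.lift f ?_, rfl⟩
  intro a b h
  induction h with
  | rel a b h => rcases h with rfl | rfl <;> simp [h1, h2]
  | refl => rfl
  | symm _ _ _ ih => exact ih.symm
  | trans _ _ _ _ _ ih1 ih2 => exact ih1.trans ih2

theorem finrank_range_componentFun_le :
    Module.finrank (ZMod 2) (LinearMap.range D.componentFun) ≤
      Nat.card (Quotient D.componentSetoid) := by
  have : Finite (Quotient D.componentSetoid) := Quotient.finite _
  have := Fintype.ofFinite (Quotient D.componentSetoid)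
  refine (LinearMap.finrank_range_le _).trans ?_
  rw [Module.finrank_fintype_fun_eq_card, Nat.card_eq_fintype_card]

/-- A function on the faces gives the sum of its values on the two sides of each arc. -/
def faceBoundary : (Quotient D.faceSetoid → ZMod 2) →ₗ[ZMod 2] (StrandEnd D.n → ZMod 2) :=
  LinearMap.funLeft _ _ (Quotient.mk _) +
    LinearMap.funLeft _ _ fun e => (Quotient.mk D.faceSetoid (D.arc e))

theorem face_rot_arc (e : StrandEnd D.n) :
    (Quotient.mk D.faceSetoid (StrandEnd.rot (D.arc e))) = Quotient.mk D.faceSetoid e :=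
  Quotient.sound (s := D.faceSetoid) (Equiv.Perm.SameCycle.symm ⟨1, rfl⟩)

theorem face_arc (e : StrandEnd D.n) :
    (Quotient.mk D.faceSetoid (D.arc e)) = Quotient.mk D.faceSetoid (StrandEnd.rot e) := by
  rw [← D.face_rot_arc (D.arc e), D.arc_arc]

theorem faceBoundary_apply (c : Quotient D.faceSetoid → ZMod 2) (e : StrandEnd D.n) :
    D.faceBoundary c e = c (Quotient.mk _ e) + c (Quotient.mk _ (D.arc e)) := rfl

theorem finrank_ker_faceBoundary_le :
    Module.finrank (ZMod 2) (LinearMap.ker D.faceBoundary) ≤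
      Nat.card (Quotient D.componentSetoid) := by
  let p : (Quotient D.faceSetoid → ZMod 2) →ₗ[ZMod 2] (StrandEnd D.n → ZMod 2) :=
    LinearMap.funLeft _ _ (Quotient.mk _)
  have hp : Function.Injective p :=
    LinearMap.funLeft_injective_of_surjective _ _ _ Quotient.mk_surjective
  rw [(Submodule.equivMapOfInjective p hp (LinearMap.ker D.faceBoundary)).finrank_eq]
  refine (Submodule.finrank_mono ?_).trans D.finrank_range_componentFun_le
  rintro _ ⟨c, hc, rfl⟩
  have h1 : ∀ e, c (Quotient.mk _ (D.arc e)) = c (Quotient.mk _ e) := fun e => by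
    have := congrFun hc e
    rw [faceBoundary_apply, Pi.zero_apply, CharTwo.add_eq_zero] at this
    exact this.symm
  refine D.mem_range_componentFun h1 fun e => ?_
  change c (Quotient.mk _ (StrandEnd.rot e)) = _
  rw [← D.face_arc, h1]
  rfl

/-- The functions on the ends that come from functions on the crossings. -/
def crossingFun : (Fin D.n → ZMod 2) →ₗ[ZMod 2] (StrandEnd D.n → ZMod 2) :=
  LinearMap.funLeft _ _ Prod.fst

/-- The functions on the ends that come from functions on the arcs. -/
def arcFun : Submodule (ZMod 2) (StrandEnd D.n → ZMod 2) :=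
  LinearMap.ker (LinearMap.id + LinearMap.funLeft (ZMod 2) (ZMod 2) D.arc)

theorem mem_arcFun {f : StrandEnd D.n → ZMod 2} : f ∈ D.arcFun ↔ ∀ e, f (D.arc e) = f e := by
  rw [arcFun, LinearMap.mem_ker, funext_iff]
  refine forall_congr' fun e => ?_
  change f e + f (D.arc e) = 0 ↔ _
  rw [CharTwo.add_eq_zero, eq_comm]

theorem le_finrank_arcFun : 2 * D.n ≤ Module.finrank (ZMod 2) D.arcFun := by
  have h := LinearMap.finrank_range_add_finrank_ker
    (LinearMap.id + LinearMap.funLeft (ZMod 2) (ZMod 2) D.arc)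
  have h2 : LinearMap.range (LinearMap.id + LinearMap.funLeft (ZMod 2) (ZMod 2) D.arc) ≤
      D.arcFun := by
    rintro _ ⟨f, rfl⟩
    refine D.mem_arcFun.2 fun e => ?_
    change f (D.arc e) + f (D.arc (D.arc e)) = f e + f (D.arc e)
    rw [D.arc_arc, add_comm]
  have h3 := Submodule.finrank_mono h2
  rw [Module.finrank_fintype_fun_eq_card, Fintype.card_prod, Fintype.card_fin,
    Fintype.card_fin] at h
  change _ + Module.finrank (ZMod 2) D.arcFun = _ at h
  omega

theorem sum_arcFun_mul {f : StrandEnd D.n → ZMod 2} (hf : f ∈ D.arcFun)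
    (c : StrandEnd D.n → ZMod 2) : ∑ e, f e * (c e + c (D.arc e)) = 0 := by
  have h : ∑ e, f e * c (D.arc e) = ∑ e, f e * c e := by
    rw [← Equiv.sum_comp D.arc]
    simp only [D.arc_arc, D.mem_arcFun.1 hf]
  simp only [mul_add, Finset.sum_add_distrib]
  rw [h, CharTwo.add_self_eq_zero]

theorem sum_arcFun {f : StrandEnd D.n → ZMod 2} (hf : f ∈ D.arcFun) : ∑ e, f e = 0 := by
  refine Finset.sum_involution (fun e _ => D.arc e) ?_ ?_ ?_ ?_
  · intro e _
    rw [D.mem_arcFun.1 hf, CharTwo.add_self_eq_zero]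
  · intro e _ _
    exact D.arc_ne e
  · simp
  · simp [D.arc_arc]

theorem sum_crossingFun (g : Fin D.n → ZMod 2) : ∑ e, D.crossingFun g e = 0 := by
  rw [Fintype.sum_prod_type]
  refine Finset.sum_eq_zero fun x _ => ?_
  change ∑ _ : Fin 4, g x = 0
  rw [Finset.sum_const, Finset.card_univ, Fintype.card_fin, nsmul_eq_mul,
    show ((4 : ℕ) : ZMod 2) = 0 from rfl, zero_mul]

theorem finrank_sup_ge :
    3 * D.n ≤ Module.finrank (ZMod 2)
      (LinearMap.range D.crossingFun ⊔ D.arcFun : Submodule (ZMod 2) _) +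
        Nat.card (Quotient D.componentSetoid) := by
  have h := Submodule.finrank_sup_add_finrank_inf_eq (LinearMap.range D.crossingFun) D.arcFun
  have h1 : Module.finrank (ZMod 2) (LinearMap.range D.crossingFun) = D.n := by
    rw [LinearMap.finrank_range_of_inj, Module.finrank_fintype_fun_eq_card, Fintype.card_fin]
    exact LinearMap.funLeft_injective_of_surjective _ _ _ fun x => ⟨(x, 0), rfl⟩
  have h2 : Module.finrank (ZMod 2) (LinearMap.range D.crossingFun ⊓ D.arcFun :
      Submodule (ZMod 2) _) ≤ Nat.card (Quotient D.componentSetoid) := by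
    refine (Submodule.finrank_mono ?_).trans D.finrank_range_componentFun_le
    rintro _ ⟨⟨g, rfl⟩, hg⟩
    exact D.mem_range_componentFun (D.mem_arcFun.1 hg) fun e => rfl
  have h3 := D.le_finrank_arcFun
  omega

theorem dotProductEquiv_mem_dualAnnihilator {f : StrandEnd D.n → ZMod 2}
    (hf : f ∈ LinearMap.range D.crossingFun ⊔ D.arcFun) :
    dotProductEquiv (ZMod 2) _ f ∈ (LinearMap.range D.faceBoundary).dualAnnihilator := by
  rw [Submodule.mem_dualAnnihilator]
  rintro _ ⟨c, rfl⟩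
  obtain ⟨_, ⟨g, rfl⟩, a, ha, rfl⟩ := Submodule.mem_sup.1 hf
  rw [map_add, LinearMap.add_apply]
  change ∑ e, D.crossingFun g e * D.faceBoundary c e + ∑ e, a e * D.faceBoundary c e = 0
  rw [show ∑ e, a e * D.faceBoundary c e = 0 from D.sum_arcFun_mul ha _, add_zero]
  simp only [faceBoundary_apply, face_arc, mul_add, Finset.sum_add_distrib]
  have : ∑ e, D.crossingFun g e * c (Quotient.mk _ (StrandEnd.rot e)) =
      ∑ e, D.crossingFun g e * c (Quotient.mk _ e) :=
    Equiv.sum_comp StrandEnd.rot fun e => D.crossingFun g e * c (Quotient.mk D.faceSetoid e)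
  rw [this, CharTwo.add_self_eq_zero]

/-- A planar diagram has a checkerboard colouring. -/
theorem one_mem_range_faceBoundary : 1 ∈ LinearMap.range D.faceBoundary := by
  have : Finite (Quotient D.faceSetoid) := Quotient.finite _
  have := Fintype.ofFinite (Quotient D.faceSetoid)
  let W := LinearMap.range D.crossingFun ⊔ D.arcFun
  have hrk := LinearMap.finrank_range_add_finrank_ker D.faceBoundary
  have hann := Subspace.finrank_add_finrank_dualAnnihilator_eq (LinearMap.range D.faceBoundary)
  have hle : W.map (dotProductEquiv (ZMod 2) (StrandEnd D.n)).toLinearMap ≤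
      (LinearMap.range D.faceBoundary).dualAnnihilator := by
    rintro _ ⟨f, hf, rfl⟩
    exact D.dotProductEquiv_mem_dualAnnihilator hf
  have hW := LinearEquiv.finrank_map_eq (dotProductEquiv (ZMod 2) (StrandEnd D.n)) W
  have hker := D.finrank_ker_faceBoundary_le
  have hsup := D.finrank_sup_ge
  have hpl : Nat.card (Quotient D.faceSetoid) = D.n + 2 * Nat.card (Quotient D.componentSetoid) :=
    D.planar
  rw [Module.finrank_fintype_fun_eq_card, ← Nat.card_eq_fintype_card] at hrk
  rw [Module.finrank_fintype_fun_eq_card, Fintype.card_prod, Fintype.card_fin,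
    Fintype.card_fin] at hann
  have heq := Submodule.eq_of_le_of_finrank_le hle (by
    refine le_of_le_of_eq ?_ hW.symm
    change _ ≤ Module.finrank (ZMod 2) W
    change _ ≤ Module.finrank (ZMod 2) W + _ at hsup
    omega)
  by_contra hone
  obtain ⟨f, hf1, hf2⟩ := Submodule.exists_dual_map_eq_bot_of_notMem hone inferInstance
  have hf3 : f ∈ (LinearMap.range D.faceBoundary).dualAnnihilator := by
    rw [Submodule.mem_dualAnnihilator]
    intro w hw
    have : f w ∈ (LinearMap.range D.faceBoundary).map f := ⟨w, hw, rfl⟩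
    rwa [hf2] at this
  rw [← heq] at hf3
  obtain ⟨w, hw, rfl⟩ := hf3
  obtain ⟨_, ⟨g, rfl⟩, a, ha, rfl⟩ := Submodule.mem_sup.1 hw
  refine hf1 ?_
  change (D.crossingFun g + a) ⬝ᵥ 1 = 0
  rw [dotProduct_one, show ∑ e, (D.crossingFun g + a) e = ∑ e, D.crossingFun g e + ∑ e, a e from
    Finset.sum_add_distrib, D.sum_crossingFun, D.sum_arcFun ha, add_zero]

/-- The ends of the strands of a planar diagram can be given alternating colours at all crossings
and along all arcs. -/
theorem exists_alternating : ∃ κ : StrandEnd D.n → Bool,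
    (∀ e, κ (D.arc e) = !κ e) ∧ ∀ e, κ (StrandEnd.rot e) = !κ e := by
  obtain ⟨c, hc⟩ := D.one_mem_range_faceBoundary
  have key : ∀ a b : ZMod 2, a + b = 1 → decide (b = 0) = !decide (a = 0) := by decide
  have h : ∀ e, decide (c (Quotient.mk _ (D.arc e)) = 0) =
      !decide (c (Quotient.mk _ e) = 0) := fun e => key _ _ (congrFun hc e)
  refine ⟨fun e => decide (c (Quotient.mk _ e) = 0), h, fun e => ?_⟩
  rw [← h e, D.face_arc]

end Checkerboard

end LinkDiagram

/-! ### Joining two classes of a setoid -/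

section Join

variable {α : Type*}

/-- The setoid `r'` arises from `r` by joining the different classes of `a` and `b`. -/
structure Setoid.IsJoin (r r' : Setoid α) (a b : α) : Prop where
  not_rel : ¬ r a b
  rel_iff : ∀ u v, r' u v ↔ r u v ∨ (r u a ∧ r b v) ∨ (r u b ∧ r a v)

namespace Setoid.IsJoin

variable {r r' : Setoid α} {a b : α}

theorem le (h : r.IsJoin r' a b) {u v : α} (huv : r u v) : r' u v := (h.rel_iff u v).2 (Or.inl huv)

theorem rel (h : r.IsJoin r' a b) : r' a b :=
  (h.rel_iff a b).2 (Or.inr (Or.inl ⟨r.refl a, r.refl b⟩))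

/-- Two elements that become related are related to the joined classes. -/
theorem rel_of_not_rel (h : r.IsJoin r' a b) {u v : α} (h1 : ¬ r u v) (h2 : r' u v) :
    (r u a ∧ r b v) ∨ (r u b ∧ r a v) := ((h.rel_iff u v).1 h2).resolve_left h1

section Product

variable {M : Type*} [CommMonoid M] [Fintype (Quotient r)] [DecidableEq (Quotient r)]

/-- A product over the classes of `r'` other than that of `a` in terms of a product over the
classes of `r` other than those of `a` and `b`. -/
@[to_additive /-- A sum over the classes of `r'` other than that of `a` in terms of a sum over the
classes of `r` other than those of `a` and `b`. -/]
theorem prod_erase_eq [Fintype (Quotient r')] [DecidableEq (Quotient r')]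
    (h : r.IsJoin r' a b) (f : Quotient r → M) (f' : Quotient r' → M)
    (hf : ∀ e, ¬ r e a → ¬ r e b → f' (Quotient.mk _ e) = f (Quotient.mk _ e)) :
    ∏ q ∈ (Finset.univ.erase (Quotient.mk r a)).erase (Quotient.mk r b), f q =
      ∏ q ∈ Finset.univ.erase (Quotient.mk r' a), f' q := by
  refine Finset.prod_bij (fun q _ => Quotient.map' id (fun _ _ => h.le) q) ?_ ?_ ?_ ?_
  · intro q hq
    induction q using Quotient.inductionOn with | _ e
    simp only [Finset.mem_erase, Finset.mem_univ, and_true, ne_eq] at hq ⊢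
    intro H
    have H : r' e a := Quotient.exact H
    rcases (h.rel_iff e a).1 H with H | ⟨H, -⟩ | ⟨H, -⟩
    · exact hq.2 (Quotient.sound H)
    · exact hq.2 (Quotient.sound H)
    · exact hq.1 (Quotient.sound H)
  · intro q hq p hp H
    induction q using Quotient.inductionOn with | _ e
    induction p using Quotient.inductionOn with | _ e'
    simp only [Finset.mem_erase, Finset.mem_univ, and_true, ne_eq] at hq
    have H : r' e e' := Quotient.exact H
    rcases (h.rel_iff e e').1 H with H | ⟨H, -⟩ | ⟨H, -⟩
    · exact Quotient.sound H
    · exact absurd (Quotient.sound H) hq.2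
    · exact absurd (Quotient.sound H) hq.1
  · intro q hq
    induction q using Quotient.inductionOn with | _ e
    simp only [Finset.mem_erase, Finset.mem_univ, and_true, ne_eq] at hq
    have hea : ¬ r' e a := fun H => hq (Quotient.sound H)
    refine ⟨Quotient.mk r e, ?_, rfl⟩
    simp only [Finset.mem_erase, Finset.mem_univ, and_true, ne_eq]
    exact ⟨fun H => hea (r'.trans (h.le (Quotient.exact H)) (r'.symm h.rel)),
      fun H => hea (h.le (Quotient.exact H))⟩
  · intro q hq
    induction q using Quotient.inductionOn with | _ e
    simp only [Finset.mem_erase, Finset.mem_univ, and_true, ne_eq] at hq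
    exact (hf e (fun H => hq.2 (Quotient.sound H)) fun H => hq.1 (Quotient.sound H)).symm

@[to_additive]
theorem prod_eq (h : r.IsJoin r' a b) (f : Quotient r → M) : ∏ q, f q =
    (∏ q ∈ (Finset.univ.erase (Quotient.mk r a)).erase (Quotient.mk r b), f q) *
      (f (Quotient.mk _ a) * f (Quotient.mk _ b)) := by
  have hab : Quotient.mk r b ∈ Finset.univ.erase (Quotient.mk r a) := by
    simp only [Finset.mem_erase, Finset.mem_univ, and_true]
    exact fun H => h.not_rel (r.symm (Quotient.exact H))
  rw [← Finset.mul_prod_erase Finset.univ f (Finset.mem_univ (Quotient.mk r a)),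
    ← Finset.mul_prod_erase _ f hab, ← mul_assoc, mul_comm]

end Product

/-- A product over the classes of `r'` in terms of a product over the classes of `r`. -/
@[to_additive /-- A sum over the classes of `r'` in terms of a sum over the classes of `r`. -/]
theorem prod_mul_eq {M : Type*} [CommMonoid M] [Fintype (Quotient r)] [Fintype (Quotient r')]
    (h : r.IsJoin r' a b) (f : Quotient r → M) (f' : Quotient r' → M)
    (hf : ∀ e, ¬ r e a → ¬ r e b → f' (Quotient.mk _ e) = f (Quotient.mk _ e)) :
    (∏ q, f q) * f' (Quotient.mk _ a) =
      (∏ q, f' q) * (f (Quotient.mk _ a) * f (Quotient.mk _ b)) := by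
  classical
  rw [h.prod_eq f, h.prod_erase_eq f f' hf, mul_right_comm,
    Finset.prod_erase_mul _ _ (Finset.mem_univ _)]

theorem card_eq [Fintype (Quotient r)] [Fintype (Quotient r')]
    (h : r.IsJoin r' a b) : Fintype.card (Quotient r) = Fintype.card (Quotient r') + 1 := by
  have := h.sum_add_eq (M := ℕ) (fun _ => 1) (fun _ => 1) fun _ _ _ => rfl
  simp only [Finset.sum_const, Finset.card_univ, smul_eq_mul, mul_one] at this
  omega

end Setoid.IsJoin

end Join

/-! ### Cycles of a permutation composed with a transposition -/

section SwapCycles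

open Equiv Equiv.Perm

variable {α : Type*} [Fintype α] [DecidableEq α]

theorem Equiv.Perm.sameCycle_mul_swap_of_not {π : Perm α} {a b : α} (h : ¬ SameCycle π a b) :
    SameCycle (π * swap a b) a b := by
  have hab : a ≠ b := fun H => h (H ▸ SameCycle.refl π a)
  have h1 : SameCycle (π * swap a b) a (π b) := ⟨1, by simp⟩
  have key : ∀ j : ℕ, SameCycle (π * swap a b) a ((π ^ (j + 1)) b) := by
    intro j
    induction j with
    | zero => simpa using h1
    | succ j ih =>
      by_cases hj : (π ^ (j + 1)) b = b
      · rw [pow_succ', Perm.mul_apply, hj]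
        exact h1
      · have hj' : (π ^ (j + 1)) b ≠ a := fun H => h (SameCycle.symm ⟨(j + 1 : ℕ), by
          rw [zpow_natCast]; exact H⟩)
        refine ih.trans ⟨1, ?_⟩
        rw [zpow_one, Perm.mul_apply, swap_apply_of_ne_of_ne hj' hj, pow_succ' π (j + 1),
          Perm.mul_apply]
  have := key (orderOf π - 1)
  rwa [Nat.sub_add_cancel (orderOf_pos π), pow_orderOf_eq_one, Perm.one_apply] at this

theorem Equiv.Perm.not_sameCycle_mul_swap {π : Perm α} {a b : α} (hab : a ≠ b)
    (h : SameCycle π a b) : ¬ SameCycle (π * swap a b) a b := by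
  have hex : ∃ k : ℕ, (π ^ k) a = b := by
    obtain ⟨k, -, hk⟩ := h.exists_pow_eq'
    exact ⟨k, hk⟩
  let k := Nat.find hex
  have hk : (π ^ k) a = b := Nat.find_spec hex
  have hmin : ∀ j < k, (π ^ j) a ≠ b := fun j hj => Nat.find_min hex hj
  have hk0 : k ≠ 0 := fun H => hab (by rw [H] at hk; exact hk)
  have hret : ∀ j, 1 ≤ j → j ≤ k → (π ^ j) a ≠ a := by
    intro j h1 h2 H
    refine hmin (k - j) (by omega) ?_
    rw [← hk, ← Nat.sub_add_cancel h2, pow_add, Perm.mul_apply, H, Nat.add_sub_cancel]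
  have key : ∀ n : ℕ, ∃ j, 1 ≤ j ∧ j ≤ k ∧ ((π * swap a b) ^ n) b = (π ^ j) a := by
    intro n
    induction n with
    | zero => exact ⟨k, by omega, le_rfl, hk.symm⟩
    | succ n ih =>
      obtain ⟨j, h1, h2, hj⟩ := ih
      rw [pow_succ', Perm.mul_apply, hj, Perm.mul_apply]
      rcases h2.eq_or_lt with rfl | h2
      · exact ⟨1, le_rfl, h1, by rw [hk, swap_apply_right, pow_one]⟩
      · refine ⟨j + 1, by omega, h2, ?_⟩
        rw [swap_apply_of_ne_of_ne (hret j h1 h2.le) (hmin j h2), pow_succ', Perm.mul_apply]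
  intro H
  obtain ⟨n, -, hn⟩ := H.symm.exists_pow_eq'
  obtain ⟨j, h1, h2, hj⟩ := key n
  exact hret j h1 h2 (hj ▸ hn)

end SwapCycles

namespace LinkDiagram

/-! ### The saddles of a planar diagram merge or split circles -/

variable (D : LinkDiagram)

theorem smooth_of_mem {n : ℕ} {S : Finset (Fin n)} {x : Fin n} (hx : x ∈ S) (i : Fin 4) :
    smooth S (x, i) = (x, ![3, 2, 1, 0] i) := if_pos hx

theorem smooth_of_notMem {n : ℕ} {S : Finset (Fin n)} {x : Fin n} (hx : x ∉ S) (i : Fin 4) :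
    smooth S (x, i) = (x, ![1, 0, 3, 2] i) := if_neg hx

theorem smooth_smooth {n : ℕ} (S : Finset (Fin n)) (e : StrandEnd n) :
    smooth S (smooth S e) = e := by
  obtain ⟨x, i⟩ := e
  by_cases hx : x ∈ S
  · rw [smooth_of_mem hx, smooth_of_mem hx]; fin_cases i <;> rfl
  · rw [smooth_of_notMem hx, smooth_of_notMem hx]; fin_cases i <;> rfl

theorem smooth_congr {n : ℕ} {S S' : Finset (Fin n)} {e : StrandEnd n}
    (h : e.1 ∈ S' ↔ e.1 ∈ S) : smooth S' e = smooth S e := by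
  simp only [smooth, h]

variable {D}

theorem circle_arc (S : Finset (Fin D.n)) (e : StrandEnd D.n) :
    D.circleSetoid S e (D.arc e) := Relation.EqvGen.rel _ _ (Or.inl rfl)

theorem circle_smooth (S : Finset (Fin D.n)) (e : StrandEnd D.n) :
    D.circleSetoid S e (smooth S e) := Relation.EqvGen.rel _ _ (Or.inr rfl)

/-- The circles are the classes of the smallest setoid that contains the arcs and the smoothings. -/
theorem circle_le {S : Finset (Fin D.n)} {r : Setoid (StrandEnd D.n)}
    (h1 : ∀ e, r e (D.arc e)) (h2 : ∀ e, r e (smooth S e)) {a b : StrandEnd D.n}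
    (h : D.circleSetoid S a b) : r a b := by
  induction h with
  | rel a b h => rcases h with rfl | rfl <;> [exact h1 a; exact h2 a]
  | refl => exact r.refl _
  | symm _ _ _ ih => exact r.symm ih
  | trans _ _ _ _ _ ih1 ih2 => exact r.trans ih1 ih2

/-- The setoid in which the classes of `a` and `b` are joined. -/
def joinSetoid {α : Type*} (r : Setoid α) (a b : α) : Setoid α where
  r u v := r u v ∨ (r u a ∧ r b v) ∨ (r u b ∧ r a v)
  iseqv := by
    have hs : ∀ {x y}, r x y → r y x := fun h => r.symm h
    have ht : ∀ {x y z}, r x y → r y z → r x z := fun h1 h2 => r.trans h1 h2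
    refine ⟨fun u => Or.inl (r.refl u), ?_, ?_⟩
    · rintro u v (h | ⟨h1, h2⟩ | ⟨h1, h2⟩)
      · exact Or.inl (hs h)
      · exact Or.inr (Or.inr ⟨hs h2, hs h1⟩)
      · exact Or.inr (Or.inl ⟨hs h2, hs h1⟩)
    · rintro u v w (h | ⟨h1, h2⟩ | ⟨h1, h2⟩) (k | ⟨k1, k2⟩ | ⟨k1, k2⟩)
      · exact Or.inl (ht h k)
      · exact Or.inr (Or.inl ⟨ht h k1, k2⟩)
      · exact Or.inr (Or.inr ⟨ht h k1, k2⟩)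
      · exact Or.inr (Or.inl ⟨h1, ht h2 k⟩)
      · exact Or.inl (ht h1 (ht (hs (ht h2 k1)) k2))
      · exact Or.inl (ht h1 k2)
      · exact Or.inr (Or.inr ⟨h1, ht h2 k⟩)
      · exact Or.inl (ht h1 k2)
      · exact Or.inl (ht h1 (ht (hs (ht h2 k1)) k2))

/-- If two resolutions differ only at `x`, the circles of each refine those of the other after
a band at `x`. -/
theorem circle_le_joinSetoid {S S' : Finset (Fin D.n)} {x : Fin D.n}
    (h : ∀ y ≠ x, (y ∈ S' ↔ y ∈ S)) (hx : x ∈ S' ↔ x ∉ S) {a b : StrandEnd D.n}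
    (hab : D.circleSetoid S' a b) : joinSetoid (D.circleSetoid S) (x, 0) (x, 2) a b := by
  refine circle_le (fun e => Or.inl (circle_arc S e)) (fun e => ?_) hab
  obtain ⟨y, i⟩ := e
  by_cases hy : y = x
  · subst hy
    have hr : ∀ j, D.circleSetoid S (y, j) (y, j) := fun j => (D.circleSetoid S).refl _
    have hs : ∀ j, D.circleSetoid S (y, j) (smooth S (y, j)) := fun j => circle_smooth S _
    by_cases hyS : y ∈ S
    · rw [smooth_of_notMem (fun H => hx.1 H hyS)]
      simp only [smooth_of_mem hyS] at hs
      fin_cases i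
      · exact Or.inr (Or.inl ⟨hr 0, hs 2⟩)
      · exact Or.inr (Or.inr ⟨hs 1, hr 0⟩)
      · exact Or.inr (Or.inr ⟨hr 2, hs 0⟩)
      · exact Or.inr (Or.inl ⟨hs 3, hr 2⟩)
    · rw [smooth_of_mem (hx.2 hyS)]
      simp only [smooth_of_notMem hyS] at hs
      fin_cases i
      · exact Or.inr (Or.inl ⟨hr 0, hs 2⟩)
      · exact Or.inr (Or.inl ⟨hs 1, hr 2⟩)
      · exact Or.inr (Or.inr ⟨hr 2, hs 0⟩)
      · exact Or.inr (Or.inr ⟨hs 3, hr 0⟩)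
  · rw [smooth_congr (h y hy)]
    exact Or.inl (circle_smooth S _)

theorem isJoin_of_rel {S S' : Finset (Fin D.n)} {x : Fin D.n}
    (h : ∀ y ≠ x, (y ∈ S' ↔ y ∈ S)) (hx : x ∈ S' ↔ x ∉ S)
    (h1 : ¬ D.circleSetoid S (x, 0) (x, 2)) (h2 : D.circleSetoid S' (x, 0) (x, 2)) :
    (D.circleSetoid S).IsJoin (D.circleSetoid S') (x, 0) (x, 2) := by
  refine ⟨h1, fun u v => ⟨circle_le_joinSetoid h hx, fun huv => ?_⟩⟩
  have hle : ∀ {u v}, D.circleSetoid S u v → D.circleSetoid S' u v := by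
    intro u v huv
    rcases circle_le_joinSetoid (fun y hy => (h y hy).symm) (by tauto) huv with H | H | H
    · exact H
    · exact (D.circleSetoid S').trans H.1 ((D.circleSetoid S').trans h2 H.2)
    · exact (D.circleSetoid S').trans H.1
        ((D.circleSetoid S').trans ((D.circleSetoid S').symm h2) H.2)
  rcases huv with H | H | H
  · exact hle H
  · exact (D.circleSetoid S').trans (hle H.1) ((D.circleSetoid S').trans h2 (hle H.2))
  · exact (D.circleSetoid S').trans (hle H.1)
      ((D.circleSetoid S').trans ((D.circleSetoid S').symm h2) (hle H.2))

variable (D) in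
/-- The permutation of the ends that goes along the circles of a resolution: across a smoothed
crossing and along an arc. -/
def walk (S : Finset (Fin D.n)) : Equiv.Perm (StrandEnd D.n) :=
  D.arc * ⟨smooth S, smooth S, smooth_smooth S, smooth_smooth S⟩

theorem walk_apply (S : Finset (Fin D.n)) (e : StrandEnd D.n) :
    D.walk S e = D.arc (smooth S e) := rfl

section Alternating

variable {κ : StrandEnd D.n → Bool} (h1 : ∀ e, κ (D.arc e) = !κ e)
  (h2 : ∀ e, κ (StrandEnd.rot e) = !κ e)

include h2 in
theorem alternating_mk (x : Fin D.n) (i : Fin 4) : κ (x, i + 1) = !κ (x, i) := h2 (x, i)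

include h2 in
theorem alternating_smooth (S : Finset (Fin D.n)) (e : StrandEnd D.n) :
    κ (smooth S e) = !κ e := by
  obtain ⟨x, i⟩ := e
  have k0 : κ (x, 1) = !κ (x, 0) := alternating_mk h2 x 0
  have k1 : κ (x, 2) = !κ (x, 1) := alternating_mk h2 x 1
  have k2 : κ (x, 3) = !κ (x, 2) := alternating_mk h2 x 2
  by_cases hx : x ∈ S
  · rw [smooth_of_mem hx]
    fin_cases i <;> simp [k0, k1, k2]
  · rw [smooth_of_notMem hx]
    fin_cases i <;> simp [k0, k1, k2]

include h1 h2

theorem alternating_walk (S : Finset (Fin D.n)) (e : StrandEnd D.n) : κ (D.walk S e) = κ e := by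
  rw [walk_apply, h1, alternating_smooth h2, Bool.not_not]

/-- Two ends of the first colour are on the same circle if the walk leads from one to the other. -/
theorem circle_iff_sameCycle (S : Finset (Fin D.n)) {a b : StrandEnd D.n} (ha : κ a = true)
    (hb : κ b = true) : D.circleSetoid S a b ↔ (D.walk S).SameCycle a b := by
  constructor
  · intro h
    let N : StrandEnd D.n → StrandEnd D.n := fun e => if κ e then e else D.arc e
    have key := circle_le (r := (Equiv.Perm.SameCycle.setoid (D.walk S)).comap N)
      (S := S) (D := D) ?_ ?_ h
    · have key : (D.walk S).SameCycle (N a) (N b) := key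
      simpa only [N, ha, hb, if_true] using key
    · intro e
      change (D.walk S).SameCycle (N e) (N (D.arc e))
      rcases he : κ e with _ | _ <;> simp [N, he, h1, D.arc_arc, Equiv.Perm.SameCycle.refl]
    · intro e
      change (D.walk S).SameCycle (N e) (N (smooth S e))
      rcases he : κ e with _ | _
      · simp only [N, he, alternating_smooth h2]
        refine Equiv.Perm.SameCycle.symm ⟨1, ?_⟩
        rw [zpow_one, walk_apply]
        simp [smooth_smooth]
      · simp only [N, he, alternating_smooth h2]
        exact ⟨1, by rw [zpow_one, walk_apply]; simp⟩
  · intro h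
    obtain ⟨k, -, hk⟩ := h.exists_pow_eq'
    subst hk
    clear hb h
    induction k with
    | zero => exact (D.circleSetoid S).refl _
    | succ k ih =>
      rw [pow_succ', Equiv.Perm.mul_apply, walk_apply]
      exact (D.circleSetoid S).trans ih ((D.circleSetoid S).trans (circle_smooth S _)
        (circle_arc S _))

theorem saddle_iff_of_alternating {S : Finset (Fin D.n)} {x : Fin D.n} (hx : x ∉ S)
    (hκ : κ (x, 0) = true) : D.circleSetoid (insert x S) (x, 0) (x, 2) ↔
      ¬ D.circleSetoid S (x, 0) (x, 2) := by
  have k0 : κ (x, 1) = !κ (x, 0) := alternating_mk h2 x 0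
  have k1 : κ (x, 2) = !κ (x, 1) := alternating_mk h2 x 1
  have k2 : κ (x, 3) = !κ (x, 2) := alternating_mk h2 x 2
  have hκ2 : κ (x, 2) = true := by rw [k1, k0, hκ]; rfl
  rw [circle_iff_sameCycle h1 h2 _ hκ hκ2, circle_iff_sameCycle h1 h2 _ hκ hκ2]
  obtain ⟨g, hg⟩ : ∃ g : Equiv.Perm (StrandEnd D.n),
      g = D.walk S * Equiv.swap (x, 0) (x, 2) := ⟨_, rfl⟩
  have hstep : ∀ e, κ e = true →
      D.walk (insert x S) e = g e := by
    rintro ⟨y, i⟩ he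
    rw [hg, Equiv.Perm.mul_apply, walk_apply, walk_apply]
    by_cases hy : y = x
    · subst hy
      rw [smooth_of_mem (Finset.mem_insert_self y S)]
      fin_cases i
      · rw [show ((y, (⟨0, by decide⟩ : Fin 4)) : StrandEnd D.n) = (y, 0) from rfl,
          Equiv.swap_apply_left, smooth_of_notMem hx]
        rfl
      · exact absurd (he.symm.trans k0) (by simp [hκ])
      · rw [show ((y, (⟨2, by decide⟩ : Fin 4)) : StrandEnd D.n) = (y, 2) from rfl,
          Equiv.swap_apply_right, smooth_of_notMem hx]
        rfl
      · exact absurd (he.symm.trans k2) (by simp [hκ2])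
    · rw [Equiv.swap_apply_of_ne_of_ne (fun H => hy (congrArg Prod.fst H))
        (fun H => hy (congrArg Prod.fst H)), smooth_congr (S := S) (S' := insert x S) (by simp [hy])]
  have hpow : ∀ k : ℕ, ((D.walk (insert x S)) ^ k) (x, 0) =
      (g ^ k) (x, 0) ∧
      κ (((D.walk (insert x S)) ^ k) (x, 0)) = true := by
    intro k
    induction k with
    | zero => exact ⟨rfl, hκ⟩
    | succ k ih =>
      rw [pow_succ', pow_succ', Equiv.Perm.mul_apply, Equiv.Perm.mul_apply, hstep _ ih.2, ih.1]
      refine ⟨rfl, ?_⟩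
      rw [← ih.1, ← hstep _ ih.2, alternating_walk h1 h2]
      exact ih.2
  have hsame : (D.walk (insert x S)).SameCycle (x, 0) (x, 2) ↔
      g.SameCycle (x, 0) (x, 2) := by
    constructor
    · intro H
      obtain ⟨k, -, hk⟩ := H.exists_pow_eq'
      exact ⟨k, by rw [zpow_natCast, ← (hpow k).1, hk]⟩
    · intro H
      obtain ⟨k, -, hk⟩ := H.exists_pow_eq'
      exact ⟨k, by rw [zpow_natCast, (hpow k).1, hk]⟩
  rw [hsame, hg]
  exact ⟨fun H H' => Equiv.Perm.not_sameCycle_mul_swap (by simp) H' H,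
    Equiv.Perm.sameCycle_mul_swap_of_not⟩

end Alternating

/-- In a planar diagram, the strands at a crossing lie on one circle after a saddle if and only if
they lie on two before it. -/
theorem saddle_iff {S : Finset (Fin D.n)} {x : Fin D.n} (hx : x ∉ S) :
    D.circleSetoid (insert x S) (x, 0) (x, 2) ↔ ¬ D.circleSetoid S (x, 0) (x, 2) := by
  obtain ⟨κ, h1, h2⟩ := D.exists_alternating
  rcases hκ : κ (x, 0) with _ | _
  · exact saddle_iff_of_alternating (κ := fun e => !κ e) (fun e => by rw [h1])
      (fun e => by rw [h2]) hx (by simp [hκ])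
  · exact saddle_iff_of_alternating h1 h2 hx hκ

/-- The saddle at `x` merges two circles of the resolution given by `S`. -/
def Merges (D : LinkDiagram) (S : Finset (Fin D.n)) (x : Fin D.n) : Prop :=
  ¬ D.circleSetoid S (x, 0) (x, 2)

theorem Merges.isJoin {S : Finset (Fin D.n)} {x : Fin D.n} (hx : x ∉ S) (h : D.Merges S x) :
    (D.circleSetoid S).IsJoin (D.circleSetoid (insert x S)) (x, 0) (x, 2) :=
  isJoin_of_rel (fun y hy => by simp [hy]) (by simp [hx]) h ((saddle_iff hx).2 h)

theorem isJoin_of_not_merges {S : Finset (Fin D.n)} {x : Fin D.n} (hx : x ∉ S)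
    (h : ¬ D.Merges S x) :
    (D.circleSetoid (insert x S)).IsJoin (D.circleSetoid S) (x, 0) (x, 2) :=
  isJoin_of_rel (fun y hy => by simp [hy]) (by simp [hx]) (fun H => h ((saddle_iff hx).1 H))
    (not_not.1 h)

end LinkDiagram

namespace LinkDiagram

variable {D : LinkDiagram}

/-! ### Coefficients and degrees of saddles -/

/-- The labels of two states agree away from the crossing `x`. -/
def AgreeAway (x : Fin D.n) (s s' : D.EnhState) : Prop :=
  (∀ e, ¬ D.circleSetoid s.res e (x, 0) → ¬ D.circleSetoid s.res e (x, 2) →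
    s'.label e = s.label e) ∧ s'.free = s.free

section Coeff

variable {F : Type*} [Field F] {x : Fin D.n} {s s' : D.EnhState}

theorem saddleCoeff_of_not_agreeAway (h t : F) (H : ¬ AgreeAway x s s') :
    D.saddleCoeff h t x s s' = 0 := if_neg H

theorem saddleCoeff_of_merges (h t : F) (hx : x ∉ s.res) (hs : s'.res = insert x s.res)
    (H : AgreeAway x s s') (hm : D.Merges s.res x) : D.saddleCoeff h t x s s' =
      mulCoeff h t (s.label (x, 0)) (s.label (x, 2)) (s'.label (x, 0)) := by
  refine (if_pos H).trans (if_pos ⟨hm, ?_⟩)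
  rw [hs]
  exact (saddle_iff hx).2 hm

theorem saddleCoeff_of_not_merges (h t : F) (hx : x ∉ s.res) (hs : s'.res = insert x s.res)
    (H : AgreeAway x s s') (hm : ¬ D.Merges s.res x) : D.saddleCoeff h t x s s' =
      comulCoeff h t (s.label (x, 0)) (s'.label (x, 0)) (s'.label (x, 2)) := by
  refine (if_pos H).trans ((if_neg fun H => hm H.1).trans (if_pos ⟨not_not.1 hm, ?_⟩))
  rw [hs]
  exact fun H => hm ((saddle_iff hx).1 H)

theorem qdeg_of_merges (hx : x ∉ s.res) (hs : s'.res = insert x s.res)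
    (H : AgreeAway x s s') (hm : D.Merges s.res x) :
    s'.qdeg = s.qdeg + EnhState.labelDeg (s'.label (x, 0)) + 1 -
      EnhState.labelDeg (s.label (x, 0)) - EnhState.labelDeg (s.label (x, 2)) := by
  have hj := hm.isJoin hx
  rw [← hs] at hj
  have h1 : ∑ c, EnhState.labelDeg (s.circleLabel c) + EnhState.labelDeg (s'.label (x, 0)) =
      ∑ c, EnhState.labelDeg (s'.circleLabel c) +
        (EnhState.labelDeg (s.label (x, 0)) + EnhState.labelDeg (s.label (x, 2))) :=
    hj.sum_add_eq (fun c => EnhState.labelDeg (s.circleLabel c))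
      (fun c => EnhState.labelDeg (s'.circleLabel c))
      fun e h1 h2 => congrArg EnhState.labelDeg (H.1 e h1 h2)
  have h4 : (s'.res.card : ℤ) = s.res.card + 1 := by
    rw [hs, Finset.card_insert_of_notMem hx]; push_cast; rfl
  simp only [EnhState.qdeg, H.2, h4]
  omega

theorem agree_of_not_merges (hx : x ∉ s.res) (hs : s'.res = insert x s.res)
    (H : AgreeAway x s s') (hm : ¬ D.Merges s.res x) (e : StrandEnd D.n)
    (h0 : ¬ D.circleSetoid s'.res e (x, 0)) (h2 : ¬ D.circleSetoid s'.res e (x, 2)) :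
    s'.label e = s.label e := by
  have hj := isJoin_of_not_merges hx hm
  rw [← hs] at hj
  refine H.1 e (fun h => ?_) (fun h => ?_)
  · rcases (hj.rel_iff _ _).1 h with h | h | h
    exacts [h0 h, h0 h.1, h2 h.1]
  · rcases (hj.rel_iff _ _).1 h with h | h | h
    exacts [h2 h, h0 h.1, h2 h.1]

theorem qdeg_of_not_merges (hx : x ∉ s.res) (hs : s'.res = insert x s.res)
    (H : AgreeAway x s s') (hm : ¬ D.Merges s.res x) :
    s'.qdeg = s.qdeg + EnhState.labelDeg (s'.label (x, 0)) +
      EnhState.labelDeg (s'.label (x, 2)) + 1 - EnhState.labelDeg (s.label (x, 0)) := by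
  have hj := isJoin_of_not_merges hx hm
  rw [← hs] at hj
  have h1 : ∑ c, EnhState.labelDeg (s'.circleLabel c) + EnhState.labelDeg (s.label (x, 0)) =
      ∑ c, EnhState.labelDeg (s.circleLabel c) +
        (EnhState.labelDeg (s'.label (x, 0)) + EnhState.labelDeg (s'.label (x, 2))) :=
    hj.sum_add_eq (fun c => EnhState.labelDeg (s'.circleLabel c))
      (fun c => EnhState.labelDeg (s.circleLabel c))
      fun e h1 h2 => congrArg EnhState.labelDeg (agree_of_not_merges hx hs H hm e h1 h2).symm
  have h4 : (s'.res.card : ℤ) = s.res.card + 1 := by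
    rw [hs, Finset.card_insert_of_notMem hx]; push_cast; rfl
  simp only [EnhState.qdeg, H.2, h4]
  omega

/-- The saddles of Khovanov homology preserve the quantum degree. -/
theorem qdeg_of_saddleCoeff_ne_zero (hx : x ∉ s.res) (hs : s'.res = insert x s.res)
    (H : D.saddleCoeff (0 : F) 0 x s s' ≠ 0) : s'.qdeg = s.qdeg := by
  have ha : AgreeAway x s s' := by
    by_contra h
    exact H (saddleCoeff_of_not_agreeAway _ _ h)
  by_cases hm : D.Merges s.res x
  · rw [saddleCoeff_of_merges _ _ hx hs ha hm] at H
    rw [qdeg_of_merges hx hs ha hm]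
    revert H
    cases s.label (x, 0) <;> cases s.label (x, 2) <;> cases s'.label (x, 0) <;>
      simp [mulCoeff, EnhState.labelDeg]
  · rw [saddleCoeff_of_not_merges _ _ hx hs ha hm] at H
    rw [qdeg_of_not_merges hx hs ha hm]
    revert H
    cases s.label (x, 0) <;> cases s'.label (x, 2) <;> cases s'.label (x, 0) <;>
      simp [comulCoeff, EnhState.labelDeg]

/-- The deformation terms of the saddles raise the quantum degree by `4` for the parameter `t`, and
by `2` for the parameter `h`. -/
theorem qdeg_of_saddleCoeff_ne {h t : F} {c : ℤ} (hc : h = 0 ∧ c = 4 ∨ t = 0 ∧ c = 2)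
    (hx : x ∉ s.res) (hs : s'.res = insert x s.res)
    (H : D.saddleCoeff h t x s s' ≠ D.saddleCoeff 0 0 x s s') : s'.qdeg = s.qdeg + c := by
  have ha : AgreeAway x s s' := by
    by_contra h
    exact H (by rw [saddleCoeff_of_not_agreeAway _ _ h, saddleCoeff_of_not_agreeAway _ _ h])
  by_cases hm : D.Merges s.res x
  · rw [saddleCoeff_of_merges _ _ hx hs ha hm, saddleCoeff_of_merges _ _ hx hs ha hm] at H
    rw [qdeg_of_merges hx hs ha hm]
    revert H
    rcases hc with ⟨rfl, rfl⟩ | ⟨rfl, rfl⟩ <;>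
    cases s.label (x, 0) <;> cases s.label (x, 2) <;> cases s'.label (x, 0) <;>
      simp [mulCoeff, EnhState.labelDeg] <;> intros <;> ring
  · rw [saddleCoeff_of_not_merges _ _ hx hs ha hm, saddleCoeff_of_not_merges _ _ hx hs ha hm] at H
    rw [qdeg_of_not_merges hx hs ha hm]
    revert H
    rcases hc with ⟨rfl, rfl⟩ | ⟨rfl, rfl⟩ <;>
    cases s.label (x, 0) <;> cases s'.label (x, 2) <;> cases s'.label (x, 0) <;>
      simp [comulCoeff, EnhState.labelDeg] <;> intros <;> ring

/-- The differential raises the homological degree by one. -/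
theorem hdeg_of_insert (hx : x ∉ s.res) (hs : s'.res = insert x s.res) :
    s'.hdeg = s.hdeg + 1 := by
  rw [EnhState.hdeg, hs, Finset.card_insert_of_notMem hx, EnhState.hdeg]
  push_cast
  ring

theorem exists_of_diffCoeff_ne {h t h' t' : F} (H : D.diffCoeff h t s s' ≠ D.diffCoeff h' t' s s') :
    ∃ x, x ∉ s.res ∧ s'.res = insert x s.res ∧
      D.saddleCoeff h t x s s' ≠ D.saddleCoeff h' t' x s s' := by
  by_contra hne
  refine H (Finset.sum_congr rfl fun x _ => ?_)
  split_ifs with hx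
  · by_cases h : D.saddleCoeff h t x s s' = D.saddleCoeff h' t' x s s'
    · rw [h]
    · exact absurd ⟨x, hx.1, hx.2, h⟩ hne
  · rfl

theorem exists_of_diffCoeff_ne_zero {h t : F} (H : D.diffCoeff h t s s' ≠ 0) :
    ∃ x, x ∉ s.res ∧ s'.res = insert x s.res ∧ D.saddleCoeff h t x s s' ≠ 0 := by
  obtain ⟨x, -, hx⟩ := Finset.exists_ne_zero_of_sum_ne_zero H
  have h1 : x ∉ s.res ∧ s'.res = insert x s.res := by
    by_contra h
    exact hx (if_neg h)
  rw [if_pos h1] at hx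
  exact ⟨x, h1.1, h1.2, right_ne_zero_of_mul hx⟩

theorem hdeg_of_diffCoeff_ne_zero {h t : F} (H : D.diffCoeff h t s s' ≠ 0) :
    s'.hdeg = s.hdeg + 1 := by
  obtain ⟨x, hx, hs, -⟩ := exists_of_diffCoeff_ne_zero H
  exact hdeg_of_insert hx hs

theorem qdeg_of_diffCoeff_ne_zero (H : D.diffCoeff (0 : F) 0 s s' ≠ 0) : s'.qdeg = s.qdeg := by
  obtain ⟨x, hx, hs, h⟩ := exists_of_diffCoeff_ne_zero H
  exact qdeg_of_saddleCoeff_ne_zero hx hs h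

theorem hdeg_of_diffCoeff_ne {h t h' t' : F} (H : D.diffCoeff h t s s' ≠ D.diffCoeff h' t' s s') :
    s'.hdeg = s.hdeg + 1 := by
  obtain ⟨x, hx, hs, -⟩ := exists_of_diffCoeff_ne H
  exact hdeg_of_insert hx hs

theorem qdeg_of_diffCoeff_ne {h t : F} {c : ℤ} (hc : h = 0 ∧ c = 4 ∨ t = 0 ∧ c = 2)
    (H : D.diffCoeff h t s s' ≠ D.diffCoeff 0 0 s s') : s'.qdeg = s.qdeg + c := by
  obtain ⟨x, hx, hs, h⟩ := exists_of_diffCoeff_ne H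
  exact qdeg_of_saddleCoeff_ne hc hx hs h

end Coeff

/-! ### The symmetries preserve the degrees -/

namespace Symmetry

variable {G : Type*} [Group G] (σ : D.Symmetry G)

theorem card_onRes (g : G) (S : Finset (Fin D.n)) : (σ.onRes g S).card = S.card :=
  Finset.card_map _

theorem qdeg_onState (g : G) (s : D.EnhState) : (σ.onState g s).qdeg = s.qdeg := by
  have h1 : ∑ c, EnhState.labelDeg ((σ.onState g s).circleLabel c) =
      ∑ c, EnhState.labelDeg (s.circleLabel c) := by
    refine (Fintype.sum_equiv (Quotient.congr (σ.onEnd g) fun a b =>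
      (σ.circle_res_iff g s a b).symm) _ _ fun c => ?_).symm
    induction c using Quotient.inductionOn with | _ e
    exact congrArg EnhState.labelDeg (σ.label_onState g s e).symm
  have h2 : ∑ c, EnhState.labelDeg ((σ.onState g s).free c) =
      ∑ c, EnhState.labelDeg (s.free c) :=
    Equiv.sum_comp (σ.onCircle g⁻¹) fun c => EnhState.labelDeg (s.free c)
  rw [EnhState.qdeg, h1, h2, res_onState, card_onRes, EnhState.qdeg]

end Symmetry

end LinkDiagram

namespace LinkDiagram

variable {D : LinkDiagram}

/-! ### The square of the differential

If `X² - hX - t` has two different roots, the elements of `A` are determined by their values at the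
roots, and the elements of the complex by their values at the colourings of the circles by the
roots. -/

section Evaluation

variable {F : Type*} [Field F] (r : Bool → F)

/-- The value of the basis vector `l` of `A` at the root `r b`. -/
def rootValue (l b : Bool) : F := if l then 1 else r b

/-- The value of an enhanced state at a colouring of the circles by the roots. -/
def weight (S : Finset (Fin D.n)) (s : D.EnhState) (c : StrandEnd D.n → Bool)
    (k : Fin D.circles → Bool) : F :=
  (∏ q : D.Circle S, rootValue r (s.label q.out) (c q.out)) * ∏ i, rootValue r (s.free i) (k i)

/-- A colouring of the ends is constant on the circles of a resolution. -/
def Compatible (S : Finset (Fin D.n)) (c : StrandEnd D.n → Bool) : Prop :=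
  ∀ e, c (D.arc e) = c e ∧ c (smooth S e) = c e

theorem Compatible.eq {S : Finset (Fin D.n)} {c : StrandEnd D.n → Bool} (hc : Compatible S c)
    {a b : StrandEnd D.n} (h : D.circleSetoid S a b) : c a = c b :=
  circle_le (r := Setoid.ker c) (fun e => (hc e).1.symm) (fun e => (hc e).2.symm) h

theorem compatible_of_eq {S : Finset (Fin D.n)} {c : StrandEnd D.n → Bool}
    (hc : ∀ a b, D.circleSetoid S a b → c a = c b) : Compatible S c :=
  fun e => ⟨(hc _ _ (circle_arc S e)).symm, (hc _ _ (circle_smooth S e)).symm⟩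

/-- A colouring that is compatible with two resolutions is compatible with those between. -/
theorem Compatible.between {S T U : Finset (Fin D.n)} {c : StrandEnd D.n → Bool}
    (hS : Compatible S c) (hU : Compatible U c) (h1 : S ⊆ T) (h2 : T ⊆ U) : Compatible T c := by
  intro e
  refine ⟨(hS e).1, ?_⟩
  by_cases he : e.1 ∈ T
  · rw [smooth_congr (S := U) (S' := T) (by simp [he, h2 he])]
    exact (hU e).2
  · rw [smooth_congr (S := S) (S' := T) (iff_of_false he fun h => he (h1 h))]
    exact (hS e).2

theorem circle_out {S : Finset (Fin D.n)} (e : StrandEnd D.n) :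
    D.circleSetoid S (Quotient.mk (D.circleSetoid S) e).out e :=
  Quotient.mk_out (s := D.circleSetoid S) e

theorem label_out {S : Finset (Fin D.n)} {s : D.EnhState} (hs : s.res = S) (e : StrandEnd D.n) :
    s.label (Quotient.mk (D.circleSetoid S) e).out = s.label e := by
  subst hs
  exact s.label_eq (circle_out e)

theorem not_circle_out {S : Finset (Fin D.n)} {q : D.Circle S} {e : StrandEnd D.n}
    (h : q ≠ Quotient.mk _ e) : ¬ D.circleSetoid S q.out e := fun H =>
  h (by rw [← Quotient.out_eq q]; exact Quotient.sound H)

section SaddleState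

/-- The circles away from a saddle are the same before and after it. -/
theorem away_iff {S : Finset (Fin D.n)} {x : Fin D.n} (hx : x ∉ S) (e : StrandEnd D.n) :
    (D.circleSetoid (insert x S) e (x, 0) ∨ D.circleSetoid (insert x S) e (x, 2)) ↔
      (D.circleSetoid S e (x, 0) ∨ D.circleSetoid S e (x, 2)) := by
  have key : ∀ {S S' : Finset (Fin D.n)}, (∀ y ≠ x, (y ∈ S' ↔ y ∈ S)) → (x ∈ S' ↔ x ∉ S) →
      (D.circleSetoid S' e (x, 0) ∨ D.circleSetoid S' e (x, 2)) →
      (D.circleSetoid S e (x, 0) ∨ D.circleSetoid S e (x, 2)) := by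
    rintro S S' h hx (H | H)
    all_goals
      rcases circle_le_joinSetoid h hx H with K | K | K
      · tauto
      · exact Or.inl K.1
      · exact Or.inr K.1
  exact ⟨key (fun y hy => by simp [hy]) (by simp [hx]),
    key (fun y hy => by simp [hy]) (by simp [hx])⟩

theorem circle_of_away {S : Finset (Fin D.n)} {x : Fin D.n} (hx : x ∉ S) {a b : StrandEnd D.n}
    (h0 : ¬ D.circleSetoid (insert x S) a (x, 0)) (h2 : ¬ D.circleSetoid (insert x S) a (x, 2))
    (h : D.circleSetoid (insert x S) a b) : D.circleSetoid S a b := by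
  have h3 := (not_congr (away_iff hx a)).1 (by tauto)
  rcases circle_le_joinSetoid (S := S) (x := x) (fun y hy => by simp [hy]) (by simp [hx]) h with H | H | H
  · exact H
  · exact absurd (Or.inl H.1) h3
  · exact absurd (Or.inr H.1) h3

open scoped Classical in
/-- The labels after a saddle, if the circles at the saddle are labelled by `γ` and `δ`. -/
def saddleLabel (s : D.EnhState) (x : Fin D.n) (γ δ : Bool) (e : StrandEnd D.n) : Bool :=
  if D.circleSetoid (insert x s.res) e (x, 0) then γ
  else if D.circleSetoid (insert x s.res) e (x, 2) then δ else s.label e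

theorem saddleLabel_eq {s : D.EnhState} {x : Fin D.n} (hx : x ∉ s.res) (γ δ : Bool)
    {a b : StrandEnd D.n} (h : D.circleSetoid (insert x s.res) a b) :
    saddleLabel s x γ δ a = saddleLabel s x γ δ b := by
  have hr : ∀ e, D.circleSetoid (insert x s.res) a e ↔ D.circleSetoid (insert x s.res) b e :=
    fun e => ⟨(D.circleSetoid _).trans ((D.circleSetoid _).symm h), (D.circleSetoid _).trans h⟩
  unfold saddleLabel
  by_cases h0 : D.circleSetoid (insert x s.res) a (x, 0)
  · rw [if_pos h0, if_pos ((hr _).1 h0)]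
  · rw [if_neg h0, if_neg (fun H => h0 ((hr _).2 H))]
    by_cases h2 : D.circleSetoid (insert x s.res) a (x, 2)
    · rw [if_pos h2, if_pos ((hr _).1 h2)]
    · rw [if_neg h2, if_neg (fun H => h2 ((hr _).2 H))]
      exact s.label_eq (circle_of_away hx h0 h2 h)

/-- The state after a saddle, if the circles at the saddle are labelled by `γ` and `δ`. -/
def saddleState (s : D.EnhState) (x : Fin D.n) (hx : x ∉ s.res) (γ δ : Bool) : D.EnhState :=
  ⟨(insert x s.res, saddleLabel s x γ δ, s.free), fun e =>
    ⟨(saddleLabel_eq hx γ δ (circle_arc _ e)).symm,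
      (saddleLabel_eq hx γ δ (circle_smooth _ e)).symm⟩⟩

variable {s : D.EnhState} {x : Fin D.n} (hx : x ∉ s.res) (γ δ : Bool)

theorem res_saddleState : (saddleState s x hx γ δ).res = insert x s.res := rfl

theorem label_saddleState_zero : (saddleState s x hx γ δ).label (x, 0) = γ :=
  if_pos ((D.circleSetoid _).refl _)

theorem label_saddleState_two (h : ¬ D.Merges s.res x) :
    (saddleState s x hx γ δ).label (x, 2) = δ :=
  (if_neg fun H => h ((saddle_iff hx).1 ((D.circleSetoid _).symm H))).trans
    (if_pos ((D.circleSetoid _).refl _))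

theorem agreeAway_saddleState : AgreeAway x s (saddleState s x hx γ δ) := by
  refine ⟨fun e h0 h2 => ?_, rfl⟩
  have h3 := (not_congr (away_iff hx e)).2 (by tauto)
  exact (if_neg fun H => h3 (Or.inl H)).trans (if_neg fun H => h3 (Or.inr H))

theorem eq_saddleState {s' : D.EnhState} (hs : s'.res = insert x s.res) (H : AgreeAway x s s') :
    s' = saddleState s x hx (s'.label (x, 0)) (s'.label (x, 2)) := by
  refine Subtype.ext (Prod.ext hs (Prod.ext (funext fun e => ?_) H.2))
  change s'.label e = saddleLabel s x _ _ e
  unfold saddleLabel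
  split_ifs with h0 h2
  · rw [← hs] at h0; exact s'.label_eq h0
  · rw [← hs] at h2; exact s'.label_eq h2
  · have h3 := (not_congr (away_iff hx e)).1 (by tauto)
    exact H.1 e (fun h => h3 (Or.inl h)) (fun h => h3 (Or.inr h))

end SaddleState

/-- The value of the saddle at `x` at a colouring. -/
def saddleFactor (h : F) (S : Finset (Fin D.n)) (x : Fin D.n) (c : StrandEnd D.n → Bool) : F :=
  open scoped Classical in if D.Merges S x then 1 else 2 * r (c (x, 0)) - h

variable {h t : F} (hsum : r true + r false = h) (hprod : r true * r false = -t)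

include hsum hprod

theorem sum_mulCoeff (a b c : Bool) : ∑ γ, mulCoeff h t a b γ * rootValue r γ c =
    rootValue r a c * rootValue r b c := by
  rw [Fintype.sum_bool]
  subst hsum
  obtain rfl : t = -(r true * r false) := by rw [hprod, neg_neg]
  cases a <;> cases b <;> cases c <;> simp [mulCoeff, rootValue] <;> ring

theorem sum_comulCoeff_self (a c : Bool) :
    ∑ p : Bool × Bool, comulCoeff h t a p.1 p.2 * (rootValue r p.1 c * rootValue r p.2 c) =
      (2 * r c - h) * rootValue r a c := by
  simp only [Fintype.sum_prod_type, Fintype.sum_bool]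
  subst hsum
  obtain rfl : t = -(r true * r false) := by rw [hprod, neg_neg]
  cases a <;> cases c <;> simp [comulCoeff, rootValue] <;> ring

theorem sum_comulCoeff_of_ne (a : Bool) {c c' : Bool} (hc : c ≠ c') :
    ∑ p : Bool × Bool, comulCoeff h t a p.1 p.2 * (rootValue r p.1 c * rootValue r p.2 c') =
      0 := by
  simp only [Fintype.sum_prod_type, Fintype.sum_bool]
  subst hsum
  obtain rfl : t = -(r true * r false) := by rw [hprod, neg_neg]
  cases a <;> cases c <;> cases c' <;> simp [comulCoeff, rootValue] at hc ⊢
  all_goals ring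

theorem sum_saddleCoeff_of_merges {s : D.EnhState} {x : Fin D.n} (hx : x ∉ s.res)
    {c : StrandEnd D.n → Bool} (k : Fin D.circles → Bool) (hc : Compatible (insert x s.res) c)
    (hm : D.Merges s.res x) :
    (∑ s' : D.EnhState, if s'.res = insert x s.res then
      D.saddleCoeff h t x s s' * weight r (insert x s.res) s' c k else 0) =
        weight r s.res s c k := by
  classical
  have hj := hm.isJoin hx
  have hcS : Compatible s.res c := compatible_of_eq fun a b hab => hc.eq (hj.le hab)
  have h02 : c (x, 2) = c (x, 0) := (hc.eq hj.rel).symm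
  let f : Quotient (D.circleSetoid s.res) → F := fun q => rootValue r (s.label q.out) (c q.out)
  let R : F := ∏ q ∈ (Finset.univ.erase (Quotient.mk (D.circleSetoid s.res) (x, 0))).erase
    (Quotient.mk _ (x, 2)), f q
  have hf : ∀ e, f (Quotient.mk _ e) = rootValue r (s.label e) (c e) := fun e => by
    simp only [f]
    rw [label_out rfl, hcS.eq (circle_out e)]
  have h1 : ∏ q : D.Circle s.res, rootValue r (s.label q.out) (c q.out) =
      R * (f (Quotient.mk _ (x, 0)) * f (Quotient.mk _ (x, 2))) := hj.prod_eq f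
  have h2 : ∀ s' : D.EnhState, s'.res = insert x s.res → AgreeAway x s s' →
      ∏ q : D.Circle (insert x s.res), rootValue r (s'.label q.out) (c q.out) =
      R * rootValue r (s'.label (x, 0)) (c (x, 0)) := by
    intro s' hs H
    let f' : Quotient (D.circleSetoid (insert x s.res)) → F := fun q =>
      rootValue r (s'.label q.out) (c q.out)
    have hf' : ∀ e, f' (Quotient.mk _ e) = rootValue r (s'.label e) (c e) := fun e => by
      simp only [f']
      rw [label_out hs, hc.eq (circle_out e)]
    have h3 : R = _ := hj.prod_erase_eq f f' fun e h0 h2 => by rw [hf, hf', H.1 e h0 h2]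
    rw [h3, ← hf']
    exact (Finset.prod_erase_mul Finset.univ f' (Finset.mem_univ _)).symm
  rw [← Fintype.sum_of_injective (fun γ : Bool => saddleState s x hx γ γ) (f := fun γ =>
    mulCoeff h t (s.label (x, 0)) (s.label (x, 2)) γ * rootValue r γ (c (x, 0)) *
      (R * ∏ i, rootValue r (s.free i) (k i)))]
  · rw [← Finset.sum_mul, sum_mulCoeff r hsum hprod, weight, h1, hf, hf, h02]
    ring
  · intro γ γ' H
    have := congrArg (fun s => EnhState.label s (x, 0)) H
    simpa only [label_saddleState_zero] using this
  · intro s' hs'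
    split_ifs with hs
    · rw [saddleCoeff_of_not_agreeAway, zero_mul]
      intro H
      refine hs' ⟨s'.label (x, 0), Eq.symm ?_⟩
      have h4 : s'.label (x, 2) = s'.label (x, 0) :=
        s'.label_eq (by rw [hs]; exact (D.circleSetoid _).symm hj.rel)
      have h5 := eq_saddleState hx hs H
      rwa [h4] at h5
    · rfl
  · intro γ
    rw [if_pos (res_saddleState hx γ γ), saddleCoeff_of_merges h t hx (res_saddleState hx γ γ)
      (agreeAway_saddleState hx γ γ) hm, label_saddleState_zero, weight,
      h2 _ (res_saddleState hx γ γ) (agreeAway_saddleState hx γ γ), label_saddleState_zero]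
    change _ = _ * (_ * ∏ i, rootValue r (s.free i) (k i))
    ring

theorem sum_saddleCoeff_of_not_merges {s : D.EnhState} {x : Fin D.n} (hx : x ∉ s.res)
    {c : StrandEnd D.n → Bool} (k : Fin D.circles → Bool) (hc : Compatible (insert x s.res) c)
    (hm : ¬ D.Merges s.res x) :
    (∑ s' : D.EnhState, if s'.res = insert x s.res then
      D.saddleCoeff h t x s s' * weight r (insert x s.res) s' c k else 0) =
        open scoped Classical in if Compatible s.res c then
          (2 * r (c (x, 0)) - h) * weight r s.res s c k else 0 := by
  classical
  have hj := isJoin_of_not_merges hx hm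
  let f : Quotient (D.circleSetoid (insert x s.res)) → F := fun q =>
    rootValue r (s.label q.out) (c q.out)
  have hf : ∀ e, f (Quotient.mk _ e) = rootValue r (s.label e) (c e) := fun e => by
    simp only [f]
    rw [s.label_eq (hj.le (circle_out e)), hc.eq (circle_out e)]
  let R : F := ∏ q ∈ (Finset.univ.erase (Quotient.mk (D.circleSetoid (insert x s.res))
    (x, 0))).erase (Quotient.mk _ (x, 2)), f q
  have h2 : ∀ s' : D.EnhState, s'.res = insert x s.res → AgreeAway x s s' →
      ∏ q : D.Circle (insert x s.res), rootValue r (s'.label q.out) (c q.out) =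
      R * (rootValue r (s'.label (x, 0)) (c (x, 0)) *
        rootValue r (s'.label (x, 2)) (c (x, 2))) := by
    intro s' hs H
    let f' : Quotient (D.circleSetoid (insert x s.res)) → F := fun q =>
      rootValue r (s'.label q.out) (c q.out)
    have hf' : ∀ e, f' (Quotient.mk _ e) = rootValue r (s'.label e) (c e) := fun e => by
      simp only [f']
      rw [label_out hs, hc.eq (circle_out e)]
    rw [← hf', ← hf']
    refine (hj.prod_eq f').trans (congrArg (· * _) (Finset.prod_congr rfl fun q hq => ?_))
    simp only [Finset.mem_erase, Finset.mem_univ, and_true] at hq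
    have := agree_of_not_merges hx hs H hm q.out (by rw [hs]; exact not_circle_out hq.2)
      (by rw [hs]; exact not_circle_out hq.1)
    simp only [f, f', this]
  rw [← Fintype.sum_of_injective (fun p : Bool × Bool => saddleState s x hx p.1 p.2)
    (f := fun p => comulCoeff h t (s.label (x, 0)) p.1 p.2 *
      (rootValue r p.1 (c (x, 0)) * rootValue r p.2 (c (x, 2))) *
      (R * ∏ i, rootValue r (s.free i) (k i)))]
  · rw [← Finset.sum_mul]
    split_ifs with hcS
    · have h1 : ∏ q : D.Circle s.res, rootValue r (s.label q.out) (c q.out) =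
          R * rootValue r (s.label (x, 0)) (c (x, 0)) := by
        let g : Quotient (D.circleSetoid s.res) → F := fun q =>
          rootValue r (s.label q.out) (c q.out)
        have hg : ∀ e, g (Quotient.mk _ e) = rootValue r (s.label e) (c e) := fun e => by
          simp only [g]
          rw [label_out rfl, hcS.eq (circle_out e)]
        have h3 : R = _ := hj.prod_erase_eq f g fun e _ _ => by rw [hf, hg]
        rw [h3, ← hg]
        exact (Finset.prod_erase_mul Finset.univ g (Finset.mem_univ _)).symm
      rw [← hcS.eq hj.rel, sum_comulCoeff_self r hsum hprod, weight, h1]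
      ring
    · rw [sum_comulCoeff_of_ne r hsum hprod, zero_mul]
      intro h02
      refine hcS (compatible_of_eq fun a b hab => ?_)
      rcases (hj.rel_iff a b).1 hab with H | H | H
      · exact hc.eq H
      · rw [hc.eq H.1, h02, hc.eq H.2]
      · rw [hc.eq H.1, ← h02, hc.eq H.2]
  · intro p p' H
    have h0 := congrArg (fun s => EnhState.label s (x, 0)) H
    have h2 := congrArg (fun s => EnhState.label s (x, 2)) H
    simp only [label_saddleState_zero, label_saddleState_two hx _ _ hm] at h0 h2
    exact Prod.ext h0 h2
  · intro s' hs'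
    split_ifs with hs
    · rw [saddleCoeff_of_not_agreeAway, zero_mul]
      exact fun H => hs' ⟨(s'.label (x, 0), s'.label (x, 2)), (eq_saddleState hx hs H).symm⟩
    · rfl
  · intro p
    have h3 := res_saddleState hx p.1 p.2
    have h4 := agreeAway_saddleState hx p.1 p.2
    rw [if_pos h3, saddleCoeff_of_not_merges h t hx h3 h4 hm, weight, h2 _ h3 h4,
      label_saddleState_zero, label_saddleState_two hx _ _ hm]
    change _ = _ * (_ * ∏ i, rootValue r (s.free i) (k i))
    ring

theorem sum_saddleCoeff {s : D.EnhState} {x : Fin D.n} (hx : x ∉ s.res)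
    {c : StrandEnd D.n → Bool} (k : Fin D.circles → Bool) (hc : Compatible (insert x s.res) c) :
    (∑ s' : D.EnhState, if s'.res = insert x s.res then
      D.saddleCoeff h t x s s' * weight r (insert x s.res) s' c k else 0) =
        open scoped Classical in if Compatible s.res c then
          saddleFactor r h s.res x c * weight r s.res s c k else 0 := by
  classical
  by_cases hm : D.Merges s.res x
  · rw [sum_saddleCoeff_of_merges r hsum hprod hx k hc hm, if_pos, saddleFactor, if_pos hm, one_mul]
    exact compatible_of_eq fun a b hab => hc.eq ((hm.isJoin hx).le hab)
  · rw [sum_saddleCoeff_of_not_merges r hsum hprod hx k hc hm, saddleFactor, if_neg hm]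

omit hsum hprod

/-- The values of an element of the complex, in the resolution given by `S`. -/
def evaluate (c : StrandEnd D.n → Bool) (k : Fin D.circles → Bool) (φ : D.EnhState → F)
    (S : Finset (Fin D.n)) : F := ∑ s : D.EnhState, if s.res = S then weight r S s c k * φ s else 0

/-- The value of the component at `x` of the differential at a colouring. -/
def stepFactor (h : F) (c : StrandEnd D.n → Bool) (S : Finset (Fin D.n)) (x : Fin D.n) : F :=
  open scoped Classical in if Compatible S c then
    (-1) ^ (S.filter fun y => y < x).card * saddleFactor r h S x c else 0

theorem res_eq_erase_iff {S T : Finset (Fin D.n)} {x : Fin D.n} :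
    (x ∉ T ∧ S = insert x T) ↔ x ∈ S ∧ T = S.erase x := by
  constructor
  · rintro ⟨hx, rfl⟩
    exact ⟨Finset.mem_insert_self _ _, (Finset.erase_insert hx).symm⟩
  · rintro ⟨hx, rfl⟩
    exact ⟨Finset.notMem_erase _ _, (Finset.insert_erase hx).symm⟩

include hsum hprod

theorem sum_diffCoeff (s : D.EnhState) {S : Finset (Fin D.n)} {c : StrandEnd D.n → Bool}
    (k : Fin D.circles → Bool) (hc : Compatible S c) :
    (∑ s' : D.EnhState, if s'.res = S then weight r S s' c k * D.diffCoeff h t s s' else 0) =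
      ∑ x, if x ∈ S ∧ s.res = S.erase x then
        stepFactor r h c (S.erase x) x * weight r (S.erase x) s c k else 0 := by
  classical
  have h1 : ∀ s' : D.EnhState,
      (if s'.res = S then weight r S s' c k * D.diffCoeff h t s s' else 0) =
      ∑ x, if x ∈ S ∧ s.res = S.erase x then (-1) ^ (s.res.filter fun y => y < x).card *
        (if s'.res = S then D.saddleCoeff h t x s s' * weight r S s' c k else 0) else 0 := by
    intro s'
    split_ifs with hs
    · subst hs
      rw [diffCoeff, Finset.mul_sum]
      refine Finset.sum_congr rfl fun x _ => ?_
      simp only [res_eq_erase_iff]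
      split_ifs <;> ring
    · simp
  simp only [h1]
  rw [Finset.sum_comm]
  refine Finset.sum_congr rfl fun x _ => ?_
  split_ifs with hx
  · obtain ⟨hx1, rfl⟩ := res_eq_erase_iff.2 hx
    rw [← Finset.mul_sum, sum_saddleCoeff r hsum hprod hx1 k hc, stepFactor,
      Finset.erase_insert hx1]
    split_ifs <;> ring
  · simp

theorem evaluate_diff (φ : D.EnhState → F) {S : Finset (Fin D.n)} {c : StrandEnd D.n → Bool}
    (k : Fin D.circles → Bool) (hc : Compatible S c) :
    evaluate r c k (D.diff h t φ) S =
      ∑ x ∈ S, stepFactor r h c (S.erase x) x * evaluate r c k φ (S.erase x) := by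
  classical
  have h1 : evaluate r c k (D.diff h t φ) S = ∑ s : D.EnhState, (∑ s' : D.EnhState,
      if s'.res = S then weight r S s' c k * D.diffCoeff h t s s' else 0) * φ s := by
    simp only [Finset.sum_mul]
    rw [Finset.sum_comm]
    refine Finset.sum_congr rfl fun s' _ => ?_
    change (if _ then _ * ∑ s, D.diffCoeff h t s s' * φ s else 0) = _
    split_ifs
    · rw [Finset.mul_sum]
      exact Finset.sum_congr rfl fun s _ => (mul_assoc _ _ _).symm
    · simp
  rw [h1]
  simp only [sum_diffCoeff r hsum hprod _ k hc, Finset.sum_mul]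
  rw [Finset.sum_comm, ← Finset.sum_filter_add_sum_filter_not Finset.univ (· ∈ S),
    Finset.filter_univ_mem, Finset.sum_eq_zero (s := Finset.univ.filter (· ∉ S)), add_zero]
  · refine Finset.sum_congr rfl fun x hx => ?_
    rw [evaluate, Finset.mul_sum]
    refine Finset.sum_congr rfl fun s _ => ?_
    simp only [hx, true_and]
    split_ifs <;> ring
  · intro x hx
    have hx := (Finset.mem_filter.1 hx).2
    simp [hx]

omit hsum hprod

theorem card_circle_of_merges {S : Finset (Fin D.n)} {x : Fin D.n} (hx : x ∉ S)
    (h : D.Merges S x) :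
    Fintype.card (D.Circle S) = Fintype.card (D.Circle (insert x S)) + 1 := (h.isJoin hx).card_eq

theorem card_circle_of_not_merges {S : Finset (Fin D.n)} {x : Fin D.n} (hx : x ∉ S)
    (h : ¬ D.Merges S x) :
    Fintype.card (D.Circle (insert x S)) = Fintype.card (D.Circle S) + 1 :=
  (isJoin_of_not_merges hx h).card_eq

/-- The values of the saddles at two crossings do not depend on their order. -/
theorem saddleFactor_mul (h : F) {T : Finset (Fin D.n)} {x y : Fin D.n} (hx : x ∉ T) (hy : y ∉ T)
    (hxy : x ≠ y) {c : StrandEnd D.n → Bool} (hT : Compatible T c)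
    (hc : Compatible (insert x (insert y T)) c) :
    saddleFactor r h (insert y T) x c * saddleFactor r h T y c =
      saddleFactor r h (insert x T) y c * saddleFactor r h T x c := by
  have hx' : x ∉ insert y T := by simp [hxy, hx]
  have hy' : y ∉ insert x T := by simp [hxy.symm, hy]
  have hcx : Compatible (insert x T) c := hT.between hc (Finset.subset_insert _ _)
    (Finset.insert_subset_insert _ (Finset.subset_insert _ _))
  have hcomm : insert y (insert x T) = insert x (insert y T) := Finset.insert_comm _ _ _
  have key1 : D.Merges T x → D.Merges T y → ¬ D.Merges (insert x T) y → c (x, 0) = c (y, 0) := by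
    intro h1 h2 h3
    have hj := h1.isJoin hx
    rcases hj.rel_of_not_rel h2 (not_not.1 h3) with H | H
    · exact (hT.eq H.1).symm
    · exact (hcx.eq hj.rel).trans (hT.eq H.1).symm
  have key2 : ¬ D.Merges T x → ¬ D.Merges T y → D.Merges (insert x T) y → c (x, 0) = c (y, 0) := by
    intro h1 h2 h3
    have hj := isJoin_of_not_merges hx h1
    rcases hj.rel_of_not_rel h3 (not_not.1 h2) with H | H
    · exact (hcx.eq H.1).symm
    · exact (hT.eq hj.rel).trans (hcx.eq H.1).symm
  unfold saddleFactor
  by_cases h1 : D.Merges T x <;> by_cases h2 : D.Merges T y <;>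
    by_cases h3 : D.Merges (insert x T) y <;> by_cases h4 : D.Merges (insert y T) x <;>
    simp only [h1, h2, h3, h4, if_true, if_false] <;> try ring1
  all_goals
    have k1 := card_circle_of_merges hx
    have k1' := card_circle_of_not_merges hx
    have k2 := card_circle_of_merges hy
    have k2' := card_circle_of_not_merges hy
    have k3 := card_circle_of_merges hy'
    have k3' := card_circle_of_not_merges hy'
    have k4 := card_circle_of_merges hx'
    have k4' := card_circle_of_not_merges hx'
    rw [hcomm] at k3 k3'
    simp only [h1, h2, h3, h4, not_true, not_false_iff, true_imp_iff, false_imp_iff] at k1 k1' k2 k2' k3 k3' k4 k4'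
    try omega
  · rw [key1 h1 h2 h3]
  · rw [key2 h1 h2 h3]

theorem card_filter_insert {T : Finset (Fin D.n)} {x y : Fin D.n} (hy : y ∉ T) :
    ((insert y T).filter fun z => z < x).card =
      (T.filter fun z => z < x).card + if y < x then 1 else 0 := by
  rw [Finset.filter_insert]
  split_ifs
  · exact Finset.card_insert_of_notMem fun h => hy (Finset.mem_filter.1 h).1
  · rfl

/-- The two ways around a square of the cube of resolutions cancel. -/
theorem stepFactor_mul_add (h : F) {T : Finset (Fin D.n)} {x y : Fin D.n} (hx : x ∉ T)
    (hy : y ∉ T) (hxy : x ≠ y) {c : StrandEnd D.n → Bool}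
    (hc : Compatible (insert x (insert y T)) c) :
    stepFactor r h c (insert y T) x * stepFactor r h c T y +
      stepFactor r h c (insert x T) y * stepFactor r h c T x = 0 := by
  by_cases hT : Compatible T c
  · have hcx : Compatible (insert x T) c := hT.between hc (Finset.subset_insert _ _)
      (Finset.insert_subset_insert _ (Finset.subset_insert _ _))
    have hcy : Compatible (insert y T) c := hT.between hc (Finset.subset_insert _ _)
      (Finset.subset_insert _ _)
    have h1 := saddleFactor_mul r h hx hy hxy hT hc
    simp only [stepFactor, hT, hcx, hcy, if_true, card_filter_insert hx, card_filter_insert hy,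
      pow_add]
    rcases lt_or_gt_of_ne hxy with h2 | h2
    · simp only [h2, h2.not_gt, if_true, if_false]
      linear_combination (-1) ^ (T.filter fun z => z < x).card *
        (-1) ^ (T.filter fun z => z < y).card * h1
    · simp only [h2, h2.not_gt, if_true, if_false]
      linear_combination -(-1) ^ (T.filter fun z => z < x).card *
        (-1) ^ (T.filter fun z => z < y).card * h1
  · simp [stepFactor, hT]

include hsum hprod

theorem evaluate_diff_diff (φ : D.EnhState → F) {S : Finset (Fin D.n)}
    {c : StrandEnd D.n → Bool} (k : Fin D.circles → Bool) (hc : Compatible S c) :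
    evaluate r c k (D.diff h t (D.diff h t φ)) S = 0 := by
  have h1 : ∀ x ∈ S, stepFactor r h c (S.erase x) x *
      evaluate r c k (D.diff h t φ) (S.erase x) = ∑ y ∈ S.erase x,
        stepFactor r h c (S.erase x) x * stepFactor r h c ((S.erase x).erase y) y *
          evaluate r c k φ ((S.erase x).erase y) := by
    intro x _
    by_cases hx : Compatible (S.erase x) c
    · rw [evaluate_diff r hsum hprod φ k hx, Finset.mul_sum]
      exact Finset.sum_congr rfl fun y _ => (mul_assoc _ _ _).symm
    · simp [stepFactor, hx]
  rw [evaluate_diff r hsum hprod _ k hc, Finset.sum_congr rfl h1, Finset.sum_sigma']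
  refine Finset.sum_involution (fun p _ => ⟨p.2, p.1⟩) ?_ ?_ ?_ ?_
  · rintro ⟨x, y⟩ hp
    simp only [Finset.mem_sigma, Finset.mem_erase] at hp
    obtain ⟨hx, hyx, hy⟩ := hp
    have hT : (S.erase y).erase x = (S.erase x).erase y := Finset.erase_right_comm
    have hSx : insert y ((S.erase x).erase y) = S.erase x :=
      Finset.insert_erase (Finset.mem_erase.2 ⟨hyx, hy⟩)
    have hSy : insert x ((S.erase x).erase y) = S.erase y := by
      rw [← hT]
      exact Finset.insert_erase (Finset.mem_erase.2 ⟨hyx.symm, hx⟩)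
    have := stepFactor_mul_add r h (T := (S.erase x).erase y) (x := x) (y := y) (c := c)
      (by simp) (by simp) hyx.symm (by rwa [hSx, Finset.insert_erase hx])
    rw [hSx, hSy] at this
    simp only [hT]
    rw [← add_mul, this, zero_mul]
  · rintro ⟨x, y⟩ hp _ H
    simp only [Finset.mem_sigma, Finset.mem_erase] at hp
    exact hp.2.1 (congrArg Sigma.fst H)
  · rintro ⟨x, y⟩ hp
    simp only [Finset.mem_sigma, Finset.mem_erase] at hp ⊢
    exact ⟨hp.2.2, hp.2.1.symm, hp.1⟩
  · rintro ⟨x, y⟩ _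
    rfl

omit hsum hprod

/-- The inverse of the matrix of the values of the basis vectors of `A` at the roots. -/
def rootDual (l b : Bool) : F :=
  (if l then (if b then -r false else r true) else (if b then 1 else -1)) / (r true - r false)

variable (hne : r true ≠ r false)

include hne in
theorem sum_rootDual (l l' : Bool) :
    ∑ b, rootDual r l b * rootValue r l' b = if l = l' then 1 else 0 := by
  have h1 : r true - r false ≠ 0 := sub_ne_zero.2 hne
  rw [Fintype.sum_bool]
  cases l <;> cases l' <;> simp [rootDual, rootValue] <;> field_simp <;> ring

include hne in
theorem prod_sum_rootDual {ι : Type*} [Fintype ι] [DecidableEq ι] (f g : ι → Bool) :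
    ∑ c : ι → Bool, (∏ i, rootDual r (f i) (c i)) * ∏ i, rootValue r (g i) (c i) =
      if f = g then 1 else 0 := by
  classical
  simp only [← Finset.prod_mul_distrib]
  rw [← Fintype.piFinset_univ, ← Finset.prod_univ_sum (fun _ => Finset.univ)
    fun i b => rootDual r (f i) b * rootValue r (g i) b]
  simp only [sum_rootDual r hne]
  rw [Finset.prod_ite_zero]
  simp [funext_iff]

include hne in
/-- An element of the complex vanishes if all its values do. -/
theorem eq_zero_of_evaluate {φ : D.EnhState → F}
    (H : ∀ S c k, Compatible S c → evaluate r c k φ S = 0) : φ = 0 := by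
  classical
  funext s₀
  let C : (D.Circle s₀.res → Bool) → StrandEnd D.n → Bool := fun c e => c (Quotient.mk _ e)
  have hC : ∀ c, Compatible s₀.res (C c) := fun c =>
    compatible_of_eq fun a b hab => congrArg c (Quotient.sound hab)
  have h1 : ∑ c : D.Circle s₀.res → Bool, ∑ k : Fin D.circles → Bool,
      ((∏ q, rootDual r (s₀.circleLabel q) (c q)) * ∏ i, rootDual r (s₀.free i) (k i)) *
        evaluate r (C c) k φ s₀.res = 0 :=
    Finset.sum_eq_zero fun c _ => Finset.sum_eq_zero fun k _ => by
      rw [H _ _ _ (hC c), mul_zero]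
  have h2 : ∀ s : D.EnhState, s.res = s₀.res →
      (∑ c : D.Circle s₀.res → Bool, ∑ k : Fin D.circles → Bool,
        ((∏ q, rootDual r (s₀.circleLabel q) (c q)) * ∏ i, rootDual r (s₀.free i) (k i)) *
          weight r s₀.res s (C c) k) = if s = s₀ then 1 else 0 := by
    intro s hs
    have h3 : ∀ c k, ((∏ q, rootDual r (s₀.circleLabel q) (c q)) *
        ∏ i, rootDual r (s₀.free i) (k i)) * weight r s₀.res s (C c) k =
        ((∏ q, rootDual r (s₀.circleLabel q) (c q)) *
          ∏ q : D.Circle s₀.res, rootValue r (s.label q.out) (c q)) *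
        ((∏ i, rootDual r (s₀.free i) (k i)) * ∏ i, rootValue r (s.free i) (k i)) := by
      intro c k
      simp only [weight, C, Quotient.out_eq]
      ring
    simp only [h3]
    rw [← Finset.sum_mul_sum, prod_sum_rootDual r hne s₀.circleLabel
      fun q : D.Circle s₀.res => s.label q.out, prod_sum_rootDual r hne,
      ite_zero_mul_ite_zero, one_mul]
    refine if_congr ⟨fun ⟨h4, h5⟩ => ?_, ?_⟩ rfl rfl
    · refine Subtype.ext (Prod.ext hs (Prod.ext (funext fun e => ?_) h5.symm))
      exact (label_out hs e).symm.trans (congrFun h4 (Quotient.mk _ e)).symm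
    · rintro rfl
      refine ⟨funext fun q => ?_, rfl⟩
      conv_lhs => rw [← Quotient.out_eq q]
      rfl
  have h4 : ∑ c : D.Circle s₀.res → Bool, ∑ k : Fin D.circles → Bool,
      ((∏ q, rootDual r (s₀.circleLabel q) (c q)) * ∏ i, rootDual r (s₀.free i) (k i)) *
        evaluate r (C c) k φ s₀.res =
      ∑ s : D.EnhState, if s.res = s₀.res then (∑ c : D.Circle s₀.res → Bool,
        ∑ k : Fin D.circles → Bool, ((∏ q, rootDual r (s₀.circleLabel q) (c q)) *
          ∏ i, rootDual r (s₀.free i) (k i)) * weight r s₀.res s (C c) k) * φ s else 0 := by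
    simp only [evaluate, Finset.mul_sum]
    rw [Finset.sum_congr rfl fun c _ => Finset.sum_comm, Finset.sum_comm]
    refine Finset.sum_congr rfl fun s _ => ?_
    split_ifs
    · simp only [Finset.sum_mul, mul_assoc]
    · simp
  rw [h4] at h1
  have h5 : ∀ s : D.EnhState, (if s.res = s₀.res then (∑ c : D.Circle s₀.res → Bool,
        ∑ k : Fin D.circles → Bool, ((∏ q, rootDual r (s₀.circleLabel q) (c q)) *
          ∏ i, rootDual r (s₀.free i) (k i)) * weight r s₀.res s (C c) k) * φ s else 0) =
      if s = s₀ then φ s else 0 := by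
    intro s
    split_ifs with h6 h7 h7
    · rw [h2 s h6, if_pos h7, one_mul]
    · rw [h2 s h6, if_neg h7, zero_mul]
    · exact absurd (h7 ▸ rfl) h6
    · rfl
  simp only [h5, Finset.sum_ite_eq', Finset.mem_univ, if_true] at h1
  exact h1

include hsum hprod hne in
/-- The differential squares to zero if `X² - hX - t` has two different roots. -/
theorem diff_diff_of_roots (φ : D.EnhState → F) : D.diff h t (D.diff h t φ) = 0 :=
  eq_zero_of_evaluate r hne fun _ _ k hc => evaluate_diff_diff r hsum hprod φ k hc

end Evaluation

section Square

variable {F : Type*} [Field F]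

theorem diff_diff_iff {h t : F} : (∀ φ : D.EnhState → F, D.diff h t (D.diff h t φ) = 0) ↔
    ∀ s s'' : D.EnhState, ∑ s', D.diffCoeff h t s' s'' * D.diffCoeff h t s s' = 0 := by
  have key : ∀ (φ : D.EnhState → F) s'', D.diff h t (D.diff h t φ) s'' =
      ∑ s, (∑ s', D.diffCoeff h t s' s'' * D.diffCoeff h t s s') * φ s := by
    intro φ s''
    change ∑ s', D.diffCoeff h t s' s'' * ∑ s, D.diffCoeff h t s s' * φ s = _
    simp only [Finset.mul_sum, Finset.sum_mul, mul_assoc]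
    exact Finset.sum_comm
  constructor
  · intro H s s''
    have := congrFun (H (Pi.single s 1)) s''
    rw [key, Finset.sum_eq_single s (fun b _ hb => by rw [Pi.single_eq_of_ne hb, mul_zero])
      (fun hb => absurd (Finset.mem_univ _) hb), Pi.single_eq_same, mul_one] at this
    exact this
  · intro H φ
    funext s''
    rw [key]
    simp [H]

/-- The Khovanov differential is the part of degree zero of its deformations, and it squares to
zero if one of them does. -/
theorem diff_zero_diff_zero {h t : F} {c : ℤ} (hc : h = 0 ∧ c = 4 ∨ t = 0 ∧ c = 2)
    (H : ∀ φ : D.EnhState → F, D.diff h t (D.diff h t φ) = 0) (φ : D.EnhState → F) :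
    D.diff (0 : F) 0 (D.diff 0 0 φ) = 0 := by
  have hc0 : 0 < c := by rcases hc with ⟨-, rfl⟩ | ⟨-, rfl⟩ <;> norm_num
  refine diff_diff_iff.2 (fun s s'' => ?_) φ
  by_cases hq : s''.qdeg = s.qdeg
  · refine (Finset.sum_congr rfl fun s' _ => ?_).trans (diff_diff_iff.1 H s s'')
    by_cases h1 : D.diffCoeff h t s s' = D.diffCoeff 0 0 s s'
    · by_cases h2 : D.diffCoeff h t s' s'' = D.diffCoeff 0 0 s' s''
      · rw [h1, h2]
      · have hq2 := qdeg_of_diffCoeff_ne hc h2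
        have h3 : D.diffCoeff (0 : F) 0 s s' = 0 := by
          by_contra h3
          have := qdeg_of_diffCoeff_ne_zero h3
          omega
        rw [h1, h3, mul_zero, mul_zero]
    · have hq1 := qdeg_of_diffCoeff_ne hc h1
      have h3 : D.diffCoeff (0 : F) 0 s' s'' = 0 := by
        by_contra h3
        have := qdeg_of_diffCoeff_ne_zero h3
        omega
      have h4 : D.diffCoeff h t s' s'' = D.diffCoeff 0 0 s' s'' := by
        by_contra h4
        have := qdeg_of_diffCoeff_ne hc h4
        omega
      rw [h4, h3, zero_mul, zero_mul]
  · refine Finset.sum_eq_zero fun s' _ => ?_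
    by_contra h1
    have h2 := qdeg_of_diffCoeff_ne_zero (left_ne_zero_of_mul h1)
    have h3 := qdeg_of_diffCoeff_ne_zero (right_ne_zero_of_mul h1)
    exact hq (h2.trans h3)

end Square

end LinkDiagram

section FilteredComplexes

universe w

/-- The quotient of a submodule `A` by its intersection with a submodule `B`. -/
abbrev Subquotient {R : Type*} {C : Type w} [CommRing R] [AddCommGroup C] [Module R C]
    (A B : Submodule R C) : Type w := A ⧸ B.submoduleOf A

namespace Subquotient

variable {R : Type*} {C : Type w} [CommRing R] [AddCommGroup C] [Module R C]
  {A B A' B' : Submodule R C}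

/-- The map of subquotients induced by a linear map. -/
def map (f : C →ₗ[R] C) (hA : ∀ x ∈ A, f x ∈ A') (hB : ∀ x ∈ B, f x ∈ B') :
    Subquotient A B →ₗ[R] Subquotient A' B' :=
  Submodule.mapQ _ _ (f.restrict hA) fun x hx => hB x hx

end Subquotient

/-- A linear map onto the cycles modulo boundaries identifies the homology. -/
theorem nonempty_homologyIso {R : Type*} [CommRing R] {κ : Type*} {s : ComplexShape κ}
    (K : HomologicalComplex (ModuleCat.{w} R) s) {i j k : κ} (hij : s.Rel i j) (hjk : s.Rel j k)
    {N : Type w} [AddCommGroup N] [Module R N] (S : Submodule R N) (f : N →ₗ[R] K.X j)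
    (h0 : ∀ x, (K.d j k).hom (f x) = 0)
    (hs : ∀ y, (K.d j k).hom y = 0 → ∃ x, y - f x ∈ LinearMap.range (K.d i j).hom)
    (hk : ∀ x, f x ∈ LinearMap.range (K.d i j).hom ↔ x ∈ S) :
    Nonempty (K.homology j ≅ ModuleCat.of R (N ⧸ S)) := by
  let T := K.sc' i j k
  let π : N →ₗ[R] (LinearMap.ker T.g.hom ⧸ LinearMap.range T.moduleCatToCycles) :=
    Submodule.mkQ _ ∘ₗ f.codRestrict (LinearMap.ker T.g.hom) h0
  have hmem : ∀ y : LinearMap.ker T.g.hom, y ∈ LinearMap.range T.moduleCatToCycles ↔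
      y.1 ∈ LinearMap.range (K.d i j).hom := by
    intro y
    constructor
    · rintro ⟨z, rfl⟩; exact ⟨z, rfl⟩
    · rintro ⟨z, hz⟩; exact ⟨z, Subtype.ext hz⟩
  have hπ : Function.Surjective π := by
    intro q
    obtain ⟨y, rfl⟩ := Submodule.Quotient.mk_surjective _ q
    obtain ⟨x, hx⟩ := hs y.1 y.2
    refine ⟨x, Eq.symm ?_⟩
    exact (Submodule.Quotient.eq _).2 ((hmem _).2 hx)
  have hker : LinearMap.ker π = S := by
    ext x
    rw [LinearMap.mem_ker, ← hk x]
    exact (Submodule.Quotient.mk_eq_zero _).trans (hmem _)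
  exact ⟨ShortComplex.homologyMapIso (K.isoSc' i j k (s.prev_eq' hij) (s.next_eq' hjk)) ≪≫
    T.moduleCatHomologyIso ≪≫ ((Submodule.quotEquivOfEq _ _ hker.symm).trans
      (π.quotKerEquivOfSurjective hπ)).symm.toModuleIso⟩

/-- A bigraded module with a differential `d₀ + (d - d₀)`, whose first summand preserves the
second degree and whose second summand raises it by `c`; the first degree is raised by `1`, and the
second degree is bounded.  `part i J` are the elements of first degree `i` and of second degree in
`J`. -/
structure GradedPerturbation (F : Type u) [Field F] (C : Type w) [AddCommGroup C] [Module F C]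
    (c : ℤ) where
  part : ℤ → Set ℤ → Submodule F C
  proj : Set ℤ → C →ₗ[F] C
  d₀ : C →ₗ[F] C
  d : C →ₗ[F] C
  lo : ℤ
  hi : ℤ
  c_pos : 0 < c
  part_mono : ∀ i {J K}, J ⊆ K → part i J ≤ part i K
  part_empty : ∀ i, part i ∅ = ⊥
  part_bounds : ∀ i J, part i J ≤ part i (J ∩ Set.Icc lo hi)
  proj_mem : ∀ {i J x} K, x ∈ part i J → proj K x ∈ part i (J ∩ K)
  sub_proj_mem : ∀ {i J x} K, x ∈ part i J → x - proj K x ∈ part i (J \ K)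
  d₀_mem : ∀ {i J x}, x ∈ part i J → d₀ x ∈ part (i + 1) J
  d_sub_mem : ∀ {i J x}, x ∈ part i J → d x - d₀ x ∈ part (i + 1) {q | q - c ∈ J}
  d_d : ∀ x, d (d x) = 0

namespace GradedPerturbation

variable {F : Type u} [Field F] {C : Type w} [AddCommGroup C] [Module F C] {c : ℤ}
  (T : GradedPerturbation F C c)

theorem part_eq_bot {J : Set ℤ} (i : ℤ) (h : J ∩ Set.Icc T.lo T.hi = ∅) : T.part i J = ⊥ := by
  rw [eq_bot_iff]
  exact (T.part_bounds i J).trans (by rw [h, T.part_empty])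

theorem part_le_of_inter {J K : Set ℤ} (i : ℤ) (h : J ∩ Set.Icc T.lo T.hi ⊆ K) :
    T.part i J ≤ T.part i K := (T.part_bounds i J).trans (T.part_mono i h)

theorem proj_eq_self {i : ℤ} {J K : Set ℤ} {x : C} (hx : x ∈ T.part i J) (h : J ⊆ K) :
    T.proj K x = x := by
  have := T.sub_proj_mem K hx
  rw [Set.sdiff_eq_empty.2 h, T.part_empty, Submodule.mem_bot, sub_eq_zero] at this
  exact this.symm

theorem proj_eq_zero {i : ℤ} {J K : Set ℤ} {x : C} (hx : x ∈ T.part i J) (h : J ∩ K = ∅) :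
    T.proj K x = 0 := by
  have := T.proj_mem K hx
  rwa [h, T.part_empty, Submodule.mem_bot] at this

theorem d_mem {i : ℤ} {J K : Set ℤ} {x : C} (hx : x ∈ T.part i J) (h1 : J ⊆ K)
    (h2 : ∀ q ∈ J, q + c ∈ K) : T.d x ∈ T.part (i + 1) K := by
  rw [← sub_add_cancel (T.d x) (T.d₀ x)]
  refine add_mem (T.part_mono _ ?_ (T.d_sub_mem hx)) (T.part_mono _ h1 (T.d₀_mem hx))
  intro q hq
  simpa using h2 _ hq

/-- The degrees `j, j + c, j + 2 c, …`. -/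
def ray (c j : ℤ) : Set ℤ := {q | ∃ k : ℤ, 0 ≤ k ∧ q = j + c * k}

/-- The degrees congruent to `j` modulo `c`. -/
def coset (c j : ℤ) : Set ℤ := {q | ∃ k : ℤ, q = j + c * k}

theorem ray_subset_coset (c j : ℤ) : ray c j ⊆ coset c j := fun _ ⟨k, _, h⟩ => ⟨k, h⟩

theorem ray_add_mul_subset (c j k : ℤ) (hk : 0 ≤ k) : ray c (j + c * k) ⊆ ray c j := by
  rintro q ⟨l, hl, rfl⟩
  exact ⟨k + l, by omega, by ring⟩

theorem ray_add_subset (c j : ℤ) : ray c (j + c) ⊆ ray c j := by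
  simpa using ray_add_mul_subset c j 1 zero_le_one

include T in
theorem le_of_mem_ray {j q : ℤ} (h : q ∈ ray c j) : j ≤ q := by
  obtain ⟨k, hk, rfl⟩ := h
  have := mul_nonneg T.c_pos.le hk
  omega

theorem mem_ray_iff (c j q : ℤ) : q ∈ ray c j ↔ q = j ∨ q ∈ ray c (j + c) := by
  constructor
  · rintro ⟨k, hk, rfl⟩
    rcases hk.eq_or_lt with rfl | hk
    · left; ring
    · right; exact ⟨k - 1, by omega, by ring⟩
  · rintro (rfl | h)
    · exact ⟨0, le_rfl, by ring⟩
    · exact ray_add_subset c j h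

include T in
theorem coset_inter_Ici (j : ℤ) : coset c j ∩ Set.Ici j = ray c j := by
  ext q
  constructor
  · rintro ⟨⟨k, rfl⟩, h⟩
    have h : j ≤ j + c * k := h
    refine ⟨k, ?_, rfl⟩
    by_contra hk
    have := mul_neg_of_pos_of_neg T.c_pos (not_le.1 hk)
    omega
  · exact fun h => ⟨ray_subset_coset c j h, T.le_of_mem_ray h⟩

theorem d_mem_ray {i j : ℤ} {x : C} (hx : x ∈ T.part i (ray c j)) :
    T.d x ∈ T.part (i + 1) (ray c j) := by
  refine T.d_mem hx subset_rfl ?_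
  rintro q ⟨k, hk, rfl⟩
  exact ⟨k + 1, by omega, by ring⟩

theorem d_mem_coset {i j : ℤ} {x : C} (hx : x ∈ T.part i (coset c j)) :
    T.d x ∈ T.part (i + 1) (coset c j) := by
  refine T.d_mem hx subset_rfl ?_
  rintro q ⟨k, rfl⟩
  exact ⟨k + 1, by ring⟩

/-- The differential preserves the classes of degrees modulo `c`. -/
theorem d_proj_coset {i j : ℤ} {x : C} (hx : x ∈ T.part i Set.univ) :
    T.d (T.proj (coset c j) x) = T.proj (coset c j) (T.d x) := by
  have h1 := T.d_mem_coset (T.part_mono _ Set.inter_subset_right (T.proj_mem (coset c j) hx))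
  have h2 : T.d (x - T.proj (coset c j) x) ∈ T.part (i + 1) (coset c j)ᶜ := by
    refine T.d_mem (T.sub_proj_mem (coset c j) hx) (fun q hq => hq.2) ?_
    rintro q ⟨-, hq⟩ ⟨k, hk⟩
    exact hq ⟨k - 1, by linear_combination hk⟩
  conv_rhs => rw [← sub_add_cancel x (T.proj (coset c j) x), map_add, map_add,
    T.proj_eq_self h1 subset_rfl, T.proj_eq_zero h2 (by simp), zero_add]

/-- The elements of degree `j` or more, modulo `c`, whose differential has degree at least
`j + c * u`. -/
def Z (u i j : ℤ) : Submodule F C :=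
  T.part i (ray c j) ⊓ (T.part (i + 1) (ray c (j + c * u))).comap T.d

/-- The denominator of the page `u` of the spectral sequence. -/
def B (u i j : ℤ) : Submodule F C :=
  T.Z (u - 1) i (j + c) ⊔ (T.Z (u - 1) (i - 1) (j - c * (u - 1))).map T.d

theorem mem_Z {u i j : ℤ} {x : C} : x ∈ T.Z u i j ↔
    x ∈ T.part i (ray c j) ∧ T.d x ∈ T.part (i + 1) (ray c (j + c * u)) := Iff.rfl

theorem mem_B {u i j : ℤ} {x : C} : x ∈ T.B u i j ↔
    ∃ y ∈ T.Z (u - 1) i (j + c), ∃ z ∈ T.Z (u - 1) (i - 1) (j - c * (u - 1)),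
      y + T.d z = x := by
  simp [B, Submodule.mem_sup]

theorem Z_shift_le {u u' i j : ℤ} (h : u' = u - 1) : T.Z u' i (j + c) ≤ T.Z u i j := by
  subst h
  rintro x ⟨h1, h2⟩
  refine ⟨T.part_mono _ (ray_add_subset c j) h1, ?_⟩
  have : j + c + c * (u - 1) = j + c * u := by ring
  rwa [this] at h2

theorem d_mem_Z {u i j : ℤ} {x : C} (hx : x ∈ T.Z u i j) (u' : ℤ) :
    T.d x ∈ T.Z u' (i + 1) (j + c * u) := by
  refine T.mem_Z.2 ⟨hx.2, ?_⟩
  rw [T.d_d]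
  exact zero_mem _

theorem d_mem_B {u i j i' j' : ℤ} {x : C} (hx : x ∈ T.Z (u - 1) i j) (hi : i' = i + 1)
    (hj : j' = j + c * (u - 1)) : T.d x ∈ T.B u i' j' := by
  subst hi hj
  refine T.mem_B.2 ⟨0, zero_mem _, x, ?_, zero_add _⟩
  rwa [add_sub_cancel_right, add_sub_cancel_right]

theorem d_mem_B_of_mem_B {u i j : ℤ} {x : C} (hx : x ∈ T.B u i j) :
    T.d x ∈ T.B u (i + 1) (j + c * u) := by
  obtain ⟨y, hy, z, -, rfl⟩ := T.mem_B.1 hx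
  rw [map_add, T.d_d, add_zero]
  exact T.d_mem_B hy rfl (by ring)

/-- The differential of the page `u`. -/
def pageD (u : ℤ) (p : ℤ × ℤ) : Subquotient (T.Z u p.1 p.2) (T.B u p.1 p.2) →ₗ[F]
    Subquotient (T.Z u (p + (1, c * u)).1 (p + (1, c * u)).2)
      (T.B u (p + (1, c * u)).1 (p + (1, c * u)).2) :=
  Subquotient.map T.d (fun _ hx => T.d_mem_Z hx u) (fun _ hx => T.d_mem_B_of_mem_B hx)

/-- The page `u` of the spectral sequence of the filtration by the second degree. -/
def page (u : ℤ) : HomologicalComplex (ModuleCat.{w} F)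
    (ComplexShape.up' ((1, c * u) : ℤ × ℤ)) where
  X p := ModuleCat.of F (Subquotient (T.Z u p.1 p.2) (T.B u p.1 p.2))
  d p q := if h : p + (1, c * u) = q then ModuleCat.ofHom (T.pageD u p) ≫
    eqToHom (by rw [h]) else 0
  shape p q h := dif_neg h
  d_comp_d' p q r h h' := by
    subst h h'
    simp only [dif_pos, eqToHom_refl, Category.comp_id]
    ext x
    refine (Submodule.Quotient.mk_eq_zero _).2 ?_
    change T.d (T.d x.1) ∈ T.B u _ _
    rw [T.d_d]
    exact zero_mem _

/-- The class on the page `u` of an approximate cocycle. -/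
def pageMk (u : ℤ) (p : ℤ × ℤ) : T.Z u p.1 p.2 →ₗ[F] (T.page u).X p := Submodule.mkQ _

theorem pageMk_surjective (u : ℤ) (p : ℤ × ℤ) : Function.Surjective (T.pageMk u p) :=
  Submodule.mkQ_surjective _

theorem pageMk_eq_zero {u : ℤ} {p : ℤ × ℤ} {x : T.Z u p.1 p.2} :
    T.pageMk u p x = 0 ↔ x.1 ∈ T.B u p.1 p.2 := Submodule.Quotient.mk_eq_zero _

theorem page_d_pageMk {u : ℤ} {p q : ℤ × ℤ} (h : p + (1, c * u) = q) (x : T.Z u p.1 p.2)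
    (y : T.Z u q.1 q.2) (hy : T.d x.1 = y.1) :
    ((T.page u).d p q).hom (T.pageMk u p x) = T.pageMk u q y := by
  subst h
  have h1 : (T.page u).d p (p + (1, c * u)) = ModuleCat.ofHom (T.pageD u p) := by
    simp [page]
  obtain ⟨y, hy'⟩ := y
  obtain rfl : T.d x.1 = y := hy
  rw [h1]
  rfl

theorem Z_succ_le (u i j : ℤ) : T.Z (u + 1) i j ≤ T.Z u i j := by
  rintro x ⟨h1, h2⟩
  refine ⟨h1, T.part_mono _ ?_ h2⟩
  have := ray_add_subset c (j + c * u)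
  rwa [show j + c * u + c = j + c * (u + 1) by ring] at this

theorem page_d_pageMk_eq_zero {u : ℤ} {p q : ℤ × ℤ} (h : p + (1, c * u) = q)
    (x : T.Z u p.1 p.2) :
    ((T.page u).d p q).hom (T.pageMk u p x) = 0 ↔ T.d x.1 ∈ T.B u (p.1 + 1) (p.2 + c * u) := by
  subst h
  rw [T.page_d_pageMk rfl x ⟨T.d x.1, T.d_mem_Z x.2 u⟩ rfl, pageMk_eq_zero]
  rfl

theorem pageMk_mem_range {u i j : ℤ} {q : ℤ × ℤ} (h : q + (1, c * u) = (i, j))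
    (x : T.Z u i j) :
    T.pageMk u (i, j) x ∈ LinearMap.range ((T.page u).d q (i, j)).hom ↔
      ∃ w ∈ T.Z u (i - 1) (j - c * u), x.1 - T.d w ∈ T.B u i j := by
  obtain ⟨q1, q2⟩ := q
  obtain rfl : i = q1 + 1 := (congrArg Prod.fst h).symm
  obtain rfl : j = q2 + c * u := (congrArg Prod.snd h).symm
  rw [add_sub_cancel_right, add_sub_cancel_right]
  constructor
  · rintro ⟨y, hy⟩
    obtain ⟨w, rfl⟩ := T.pageMk_surjective u _ y
    rw [T.page_d_pageMk h w ⟨T.d w.1, T.d_mem_Z w.2 u⟩ rfl, eq_comm, ← sub_eq_zero,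
      ← map_sub, pageMk_eq_zero] at hy
    exact ⟨w.1, w.2, hy⟩
  · rintro ⟨w, hw, hx⟩
    refine ⟨T.pageMk u (q1, q2) ⟨w, hw⟩, ?_⟩
    rw [T.page_d_pageMk h ⟨w, hw⟩ ⟨T.d w, T.d_mem_Z hw u⟩ rfl, eq_comm, ← sub_eq_zero,
      ← map_sub, pageMk_eq_zero]
    exact hx

theorem nonempty_iso (u : ℤ) (p : ℤ × ℤ) :
    Nonempty ((T.page u).homology p ≅ (T.page (u + 1)).X p) := by
  obtain ⟨i, j⟩ := p
  obtain ⟨q, hq⟩ : ∃ q : ℤ × ℤ, q + (1, c * u) = (i, j) :=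
    ⟨(i - 1, j - c * u), by simp⟩
  refine nonempty_homologyIso (T.page u) (i := q) (j := (i, j)) (k := (i, j) + (1, c * u))
    hq rfl ((T.B (u + 1) i j).submoduleOf (T.Z (u + 1) i j))
    (T.pageMk u (i, j) ∘ₗ Submodule.inclusion (T.Z_succ_le u i j)) ?_ ?_ ?_
  · rintro ⟨x, hx⟩
    refine (T.page_d_pageMk_eq_zero rfl _).2 (T.mem_B.2 ⟨T.d x, ⟨?_, ?_⟩, 0, zero_mem _, by simp⟩)
    · have := hx.2
      rwa [show j + c * (u + 1) = j + c * u + c by ring] at this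
    · change T.d (T.d x) ∈ T.part _ _
      rw [T.d_d]; exact zero_mem _
  · intro y hy
    obtain ⟨⟨x, hx⟩, rfl⟩ := T.pageMk_surjective u (i, j) y
    rw [T.page_d_pageMk_eq_zero rfl] at hy
    obtain ⟨y, hy, z, hz, hyz⟩ := T.mem_B.1 hy
    simp only [add_sub_cancel_right] at hz hy
    rw [show j + c * u - c * (u - 1) = j + c by ring] at hz
    have hz' := T.Z_shift_le rfl hz
    refine ⟨⟨x - z, ?_⟩, ?_⟩
    · refine T.mem_Z.2 ⟨sub_mem hx.1 hz'.1, ?_⟩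
      rw [map_sub, ← hyz, add_sub_cancel_right,
        show j + c * (u + 1) = j + c * u + c by ring]
      exact hy.1
    · rw [LinearMap.comp_apply, ← map_sub]
      rw [T.pageMk_eq_zero.2]
      · exact zero_mem _
      change x - (x - z) ∈ T.B u i j
      rw [sub_sub_cancel]
      exact T.mem_B.2 ⟨z, hz, 0, zero_mem _, by simp⟩
  · rintro ⟨x, hx⟩
    rw [LinearMap.comp_apply, T.pageMk_mem_range hq]
    change _ ↔ x ∈ T.B (u + 1) i j
    constructor
    · rintro ⟨w, hw, h⟩
      obtain ⟨y, hy, z, hz, hyz⟩ := T.mem_B.1 h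
      change _ = x - T.d w at hyz
      refine T.mem_B.2 ⟨y, T.mem_Z.2 ⟨hy.1, ?_⟩, w + z, ?_, ?_⟩
      · rw [show T.d y = T.d x by
          have := congrArg T.d hyz
          rwa [map_add, map_sub, T.d_d, T.d_d, add_zero, sub_zero] at this]
        have := (T.mem_Z.1 hx).2
        rwa [add_sub_cancel_right, show j + c + c * u = j + c * (u + 1) by ring]
      · rw [add_sub_cancel_right]
        refine add_mem hw (T.Z_shift_le rfl ?_)
        rwa [show j - c * u + c = j - c * (u - 1) by ring]
      · rw [map_add, ← add_assoc, add_right_comm, hyz, sub_add_cancel]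
    · intro h
      obtain ⟨y, hy, z, hz, hyz⟩ := T.mem_B.1 h
      rw [add_sub_cancel_right] at hy hz
      refine ⟨z, hz, T.mem_B.2 ⟨y, ?_, 0, zero_mem _, ?_⟩⟩
      · have := T.Z_succ_le (u - 1) i (j + c)
        rw [sub_add_cancel] at this
        exact this hy
      · change _ = x - T.d z
        rw [← hyz]; simp

/-- The spectral sequence of the filtration by the second degree. -/
def spectralSequence : BigradedSS.{w} F c where
  page u _ := T.page u
  iso u u' p h hu := by
    subst h
    exact (T.nonempty_iso u p).some

/-- The homology of the unperturbed differential in bidegree `(i, j)`. -/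
abbrev gradedHomology (i j : ℤ) : Type w :=
  (LinearMap.ker T.d₀ ⊓ T.part i {j} : Submodule F C) ⧸
    ((T.part (i - 1) {j}).map T.d₀).submoduleOf (LinearMap.ker T.d₀ ⊓ T.part i {j})

/-- The cocycles of the perturbed differential in degree `i`. -/
abbrev cocycles (i : ℤ) : Submodule F C := LinearMap.ker T.d ⊓ T.part i Set.univ

/-- The homology of the perturbed differential in degree `i`. -/
abbrev homology (i : ℤ) : Type w :=
  T.cocycles i ⧸ ((T.part (i - 1) Set.univ).map T.d).submoduleOf (T.cocycles i)

/-- The filtration of the homology by the second degree of cocycles. -/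
def filtration (i j : ℤ) : Submodule F (T.homology i) :=
  ((T.part i (Set.Ici j)).submoduleOf (T.cocycles i)).map (Submodule.mkQ _)

theorem proj_d {i j : ℤ} {x : C} (hx : x ∈ T.part i (ray c j)) :
    T.proj {j} (T.d x) = T.d₀ (T.proj {j} x) := by
  have hc := T.c_pos
  have h1 : T.proj {j} x ∈ T.part i {j} := T.part_mono _ Set.inter_subset_right (T.proj_mem _ hx)
  have h2 : x - T.proj {j} x ∈ T.part i (ray c (j + c)) := by
    refine T.part_mono _ ?_ (T.sub_proj_mem {j} hx)
    rintro q ⟨hq, hq'⟩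
    exact ((mem_ray_iff c j q).1 hq).resolve_left hq'
  have h3 : T.proj {j} (T.d (x - T.proj {j} x)) = 0 := by
    refine T.proj_eq_zero (T.d_mem_ray h2) (Set.eq_empty_iff_forall_notMem.2 ?_)
    rintro q ⟨hq, rfl⟩
    have := T.le_of_mem_ray hq
    omega
  have h4 : T.proj {j} (T.d (T.proj {j} x) - T.d₀ (T.proj {j} x)) = 0 := by
    refine T.proj_eq_zero (T.d_sub_mem h1) (Set.eq_empty_iff_forall_notMem.2 ?_)
    rintro q ⟨hq, rfl⟩
    have hq : q - c = q := hq
    omega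
  have h5 : T.proj {j} (T.d₀ (T.proj {j} x)) = T.d₀ (T.proj {j} x) :=
    T.proj_eq_self (T.d₀_mem h1) subset_rfl
  rw [map_sub, map_sub] at h3
  rw [map_sub] at h4
  rw [sub_eq_zero.1 h3, sub_eq_zero.1 h4, h5]

/-- The first page is the homology of the unperturbed differential. -/
theorem nonempty_page_one_equiv (i j : ℤ) :
    Nonempty ((T.page 1).X (i, j) ≃ₗ[F] T.gradedHomology i j) := by
  let f₀ : T.Z 1 i j →ₗ[F] (LinearMap.ker T.d₀ ⊓ T.part i {j} : Submodule F C) :=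
    (T.proj {j}).restrict (by
      intro x hx
      refine ⟨?_, T.part_mono _ Set.inter_subset_right (T.proj_mem _ hx.1)⟩
      rw [SetLike.mem_coe, LinearMap.mem_ker, ← T.proj_d hx.1]
      refine T.proj_eq_zero hx.2 (Set.eq_empty_iff_forall_notMem.2 ?_)
      rintro q ⟨hq, rfl⟩
      have := T.le_of_mem_ray hq
      have := T.c_pos
      omega)
  let f : T.Z 1 i j →ₗ[F] T.gradedHomology i j := Submodule.mkQ _ ∘ₗ f₀
  have hf : Function.Surjective f := by
    intro y
    obtain ⟨⟨y, hy0, hy⟩, rfl⟩ := Submodule.Quotient.mk_surjective _ y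
    have h1 : ({j} : Set ℤ) ⊆ ray c j := by
      rintro q rfl
      exact (mem_ray_iff c q q).2 (Or.inl rfl)
    refine ⟨⟨y, T.part_mono _ h1 hy, ?_⟩, ?_⟩
    · have h2 := T.d_sub_mem hy
      rw [LinearMap.mem_ker.1 hy0, sub_zero] at h2
      refine T.part_mono _ ?_ h2
      intro q hq
      have hq : q - c = j := hq
      exact ⟨0, le_rfl, by rw [mul_one, mul_zero, add_zero]; omega⟩
    · refine congrArg (Submodule.Quotient.mk) (Subtype.ext ?_)
      exact T.proj_eq_self hy subset_rfl
  have hker : LinearMap.ker f = (T.B 1 i j).submoduleOf (T.Z 1 i j) := by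
    ext ⟨x, hx⟩
    have h1 : (⟨x, hx⟩ : T.Z 1 i j) ∈ LinearMap.ker f ↔
        ∃ z ∈ T.part (i - 1) {j}, T.d₀ z = T.proj {j} x := Submodule.Quotient.mk_eq_zero _
    have h2 : (⟨x, hx⟩ : T.Z 1 i j) ∈ (T.B 1 i j).submoduleOf (T.Z 1 i j) ↔ x ∈ T.B 1 i j :=
      Iff.rfl
    have hc := T.c_pos
    rw [h1, h2, mem_B]
    simp only [sub_self, mul_zero, sub_zero]
    constructor
    · rintro ⟨z, hz, hzx⟩
      have hz' : z ∈ T.part (i - 1) (ray c j) := by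
        refine T.part_mono _ ?_ hz
        rintro q rfl
        exact (mem_ray_iff c q q).2 (Or.inl rfl)
      have hy : x - T.d z ∈ T.part i (ray c (j + c)) := by
        rw [← sub_add_sub_cancel x (T.proj {j} x), ← hzx]
        refine add_mem (T.part_mono _ ?_ (hzx ▸ T.sub_proj_mem {j} hx.1)) ?_
        · rintro q ⟨hq, hq'⟩
          exact ((mem_ray_iff c j q).1 hq).resolve_left hq'
        · rw [← neg_sub]
          have := T.d_sub_mem hz
          rw [sub_add_cancel] at this
          refine neg_mem (T.part_mono _ ?_ this)
          intro q hq
          have hq : q - c = j := hq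
          exact ⟨0, le_rfl, by omega⟩
      refine ⟨x - T.d z, ⟨hy, ?_⟩, z, ⟨hz', ?_⟩, sub_add_cancel _ _⟩
      · simpa using T.d_mem_ray hy
      · simpa using T.d_mem_ray hz'
    · rintro ⟨y, hy, z, hz, rfl⟩
      refine ⟨T.proj {j} z, T.part_mono _ Set.inter_subset_right (T.proj_mem _ hz.1), ?_⟩
      rw [map_add, T.proj_d hz.1, T.proj_eq_zero hy.1, zero_add]
      refine Set.eq_empty_iff_forall_notMem.2 ?_
      rintro q ⟨hq, rfl⟩
      have := T.le_of_mem_ray hq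
      omega
  exact ⟨(Submodule.quotEquivOfEq _ _ hker.symm).trans (f.quotKerEquivOfSurjective hf)⟩

theorem mem_filtration {i j : ℤ} (x : T.cocycles i) :
    (Submodule.Quotient.mk x : T.homology i) ∈ T.filtration i j ↔
      ∃ y ∈ T.part i (Set.Ici j), T.d y = 0 ∧ ∃ z ∈ T.part (i - 1) Set.univ, x.1 = y + T.d z := by
  constructor
  · rintro ⟨⟨y, hy⟩, hy1, hy2⟩
    obtain ⟨z, hz, hzx⟩ := (Submodule.Quotient.eq _).1 hy2
    have hzx : T.d z = y - x.1 := hzx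
    exact ⟨y, hy1, hy.1, -z, neg_mem hz, by rw [map_neg, hzx]; abel⟩
  · rintro ⟨y, hy1, hy2, z, hz, hx⟩
    refine ⟨⟨y, hy2, T.part_mono _ (Set.subset_univ _) hy1⟩, hy1, ?_⟩
    refine (Submodule.Quotient.eq _).2 ⟨-z, neg_mem hz, ?_⟩
    change T.d (-z) = y - x.1
    rw [map_neg, hx]; abel

theorem filtration_antitone (i : ℤ) : Antitone (T.filtration i) := by
  intro j k hjk
  refine Submodule.map_mono fun x hx => ?_
  exact T.part_mono _ (Set.Ici_subset_Ici.2 hjk) hx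

theorem filtration_eq_top {i j : ℤ} (hj : j ≤ T.lo) : T.filtration i j = ⊤ := by
  rw [eq_top_iff]
  rintro x -
  obtain ⟨x, rfl⟩ := Submodule.Quotient.mk_surjective _ x
  refine ⟨x, ?_, rfl⟩
  exact T.part_le_of_inter i (fun q hq => hj.trans hq.2.1) x.2.2

theorem filtration_eq_bot {i j : ℤ} (hj : T.hi < j) : T.filtration i j = ⊥ := by
  rw [eq_bot_iff]
  rintro _ ⟨x, hx, rfl⟩
  have hx : x.1 ∈ T.part i (Set.Ici j) := hx
  rw [T.part_eq_bot, Submodule.mem_bot] at hx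
  · obtain rfl : x = 0 := Subtype.ext hx
    exact zero_mem _
  · refine Set.eq_empty_iff_forall_notMem.2 ?_
    rintro q ⟨h1, h2, h3⟩
    have h1 : j ≤ q := h1
    omega

theorem Z_le_B {u i j : ℤ} (hj : j < T.lo) : T.Z u i j ≤ T.B u i j := by
  intro x hx
  refine T.mem_B.2 ⟨x, T.mem_Z.2 ⟨T.part_le_of_inter i ?_ hx.1, ?_⟩, 0, zero_mem _, by simp⟩
  · rintro q ⟨h1, h2, h3⟩
    exact ((mem_ray_iff c j q).1 h1).resolve_left (by omega)
  · rw [show j + c + c * (u - 1) = j + c * u by ring]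
    exact hx.2

theorem part_ray_eq_bot {j : ℤ} (i : ℤ) (hj : T.hi < j) : T.part i (ray c j) = ⊥ := by
  refine T.part_eq_bot i (Set.eq_empty_iff_forall_notMem.2 ?_)
  rintro q ⟨h1, h2, h3⟩
  have := T.le_of_mem_ray h1
  omega

theorem page_d_eq_zero {u : ℤ} (hu : T.hi - T.lo < u) (hu' : 1 ≤ u) (p q : ℤ × ℤ) :
    (T.page u).d p q = 0 := by
  by_cases h : p + (1, c * u) = q
  · ext y
    obtain ⟨x, rfl⟩ := T.pageMk_surjective u p y
    refine (T.page_d_pageMk_eq_zero h x).2 ?_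
    rcases lt_or_ge p.2 T.lo with hp | hp
    · exact T.d_mem_B_of_mem_B (T.Z_le_B hp x.2)
    · have h1 := (T.mem_Z.1 x.2).2
      have := le_mul_of_one_le_left (by omega : 0 ≤ u) (show 1 ≤ c from T.c_pos)
      rw [T.part_ray_eq_bot _ (by omega), Submodule.mem_bot] at h1
      rw [h1]
      exact zero_mem _
  · exact (T.page u).shape p q h

/-- The pages become the associated graded modules of the homology. -/
theorem nonempty_page_equiv {u : ℤ} (hu : T.hi - T.lo + 1 < u) (hu' : 1 ≤ u) (i j : ℤ) :
    Nonempty ((T.page u).X (i, j) ≃ₗ[F]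
      (T.filtration i j ⧸ (T.filtration i (j + 1)).submoduleOf (T.filtration i j))) := by
  have hc := T.c_pos
  have htriv : (T.Z u i j ≤ T.B u i j) → (T.filtration i j ≤ T.filtration i (j + 1)) →
      Nonempty ((T.page u).X (i, j) ≃ₗ[F]
      (T.filtration i j ⧸ (T.filtration i (j + 1)).submoduleOf (T.filtration i j))) := by
    intro h1 h2
    have h3 : Subsingleton ((T.page u).X (i, j)) := by
      refine subsingleton_of_forall_eq 0 fun y => ?_
      obtain ⟨x, rfl⟩ := T.pageMk_surjective u (i, j) y
      exact T.pageMk_eq_zero.2 (h1 x.2)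
    have h4 : Subsingleton
        (T.filtration i j ⧸ (T.filtration i (j + 1)).submoduleOf (T.filtration i j)) := by
      refine subsingleton_of_forall_eq 0 fun y => ?_
      obtain ⟨x, rfl⟩ := Submodule.Quotient.mk_surjective _ y
      exact (Submodule.Quotient.mk_eq_zero _).2 (h2 x.2)
    exact ⟨⟨0, 0, fun _ => Subsingleton.elim _ _, fun _ => Subsingleton.elim _ _⟩⟩
  rcases lt_or_ge j T.lo with hj | hj
  · refine htriv (T.Z_le_B hj) ?_
    rw [T.filtration_eq_top (j := j + 1) (by omega)]
    exact le_top
  rcases lt_or_ge T.hi j with hj' | hj'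
  · refine htriv ?_ ?_
    · intro x hx
      have := hx.1
      rw [T.part_ray_eq_bot i hj', SetLike.mem_coe, Submodule.mem_bot] at this
      rw [this]
      exact zero_mem _
    · rw [T.filtration_eq_bot hj']
      exact bot_le
  have hcu := le_mul_of_one_le_left (by omega : 0 ≤ u) (show 1 ≤ c from T.c_pos)
  have hcu' := le_mul_of_one_le_left (by omega : 0 ≤ u - 1) (show 1 ≤ c from T.c_pos)
  have hZ : ∀ x ∈ T.Z u i j, T.d x = 0 := by
    intro x hx
    have h1 := (T.mem_Z.1 hx).2
    rwa [T.part_ray_eq_bot _ (by omega), Submodule.mem_bot] at h1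
  have hZK : T.Z u i j ≤ T.cocycles i := fun x hx =>
    ⟨hZ x hx, T.part_mono _ (Set.subset_univ _) hx.1⟩
  let f₀ : T.Z u i j →ₗ[F] T.filtration i j :=
    (Submodule.mkQ _ ∘ₗ Submodule.inclusion hZK).codRestrict (T.filtration i j) (by
      intro x
      refine ⟨Submodule.inclusion hZK x, ?_, rfl⟩
      exact T.part_mono _ (fun q hq => T.le_of_mem_ray hq) x.2.1)
  let f : T.Z u i j →ₗ[F]
      (T.filtration i j ⧸ (T.filtration i (j + 1)).submoduleOf (T.filtration i j)) :=
    Submodule.mkQ _ ∘ₗ f₀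
  have hIci : coset c j ∩ Set.Ici (j + 1) ⊆ ray c (j + c) := by
    rintro q ⟨h1, h2⟩
    have h2 : j + 1 ≤ q := h2
    have h3 : q ∈ ray c j := T.coset_inter_Ici j ▸ ⟨h1, by
      change j ≤ q
      omega⟩
    exact ((mem_ray_iff c j q).1 h3).resolve_left (by omega)
  have hf : Function.Surjective f := by
    intro y
    obtain ⟨⟨_, ⟨x, hx1, rfl⟩⟩, rfl⟩ := Submodule.Quotient.mk_surjective _ y
    have hx1 : x.1 ∈ T.part i (Set.Ici j) := hx1
    have hx2 : T.d x.1 = 0 := x.2.1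
    have h1 := T.proj_mem (coset c j) hx1
    rw [Set.inter_comm, T.coset_inter_Ici] at h1
    have h2 : T.d (T.proj (coset c j) x.1) = 0 := by
      rw [T.d_proj_coset x.2.2, hx2, map_zero]
    refine ⟨⟨T.proj (coset c j) x.1, T.mem_Z.2 ⟨h1, by rw [h2]; exact zero_mem _⟩⟩, ?_⟩
    refine (Submodule.Quotient.eq _).2 ?_
    change Submodule.Quotient.mk (⟨T.proj (coset c j) x.1, _⟩ - x) ∈ T.filtration i (j + 1)
    refine (T.mem_filtration _).2 ⟨T.proj (coset c j) x.1 - x.1, ?_, by rw [map_sub, h2, hx2, sub_zero],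
      0, zero_mem _, by rw [map_zero, add_zero]; rfl⟩
    rw [← neg_sub]
    refine neg_mem (T.part_mono _ ?_ (T.sub_proj_mem (coset c j) hx1))
    rintro q ⟨hq, hq'⟩
    have hq : j ≤ q := hq
    refine Int.add_one_le_iff.2 (lt_of_le_of_ne hq ?_)
    rintro rfl
    exact hq' ⟨0, by simp⟩
  have hker : LinearMap.ker f = (T.B u i j).submoduleOf (T.Z u i j) := by
    ext ⟨x, hx⟩
    have h1 : (⟨x, hx⟩ : T.Z u i j) ∈ LinearMap.ker f ↔
        ∃ y ∈ T.part i (Set.Ici (j + 1)), T.d y = 0 ∧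
          ∃ z ∈ T.part (i - 1) Set.univ, x = y + T.d z :=
      (Submodule.Quotient.mk_eq_zero _).trans (T.mem_filtration ⟨x, hZK hx⟩)
    have h2 : (⟨x, hx⟩ : T.Z u i j) ∈ (T.B u i j).submoduleOf (T.Z u i j) ↔ x ∈ T.B u i j :=
      Iff.rfl
    rw [h1, h2, mem_B]
    constructor
    · rintro ⟨y, hy, hdy, z, hz, rfl⟩
      have hy' : T.proj (coset c j) y ∈ T.part i (ray c (j + c)) := by
        refine T.part_mono _ ?_ (T.proj_mem (coset c j) hy)
        rwa [Set.inter_comm]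
      have hz' : T.proj (coset c j) z ∈ T.part (i - 1) (ray c (j - c * (u - 1))) := by
        refine T.part_le_of_inter _ ?_ (T.proj_mem (coset c j) hz)
        rintro q ⟨⟨-, k, rfl⟩, h3, -⟩
        refine ⟨k + (u - 1), ?_, by ring⟩
        by_contra hk
        have := mul_neg_of_pos_of_neg hc (not_le.1 hk)
        rw [mul_add] at this
        omega
      have hyu : y ∈ T.part i Set.univ := T.part_mono _ (Set.subset_univ _) hy
      have hx' : T.proj (coset c j) y + T.d (T.proj (coset c j) z) = y + T.d z := by
        rw [T.d_proj_coset hz, ← map_add]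
        exact T.proj_eq_self hx.1 (ray_subset_coset c j)
      refine ⟨_, T.mem_Z.2 ⟨hy', ?_⟩, _, T.mem_Z.2 ⟨hz', ?_⟩, hx'⟩
      · rw [T.d_proj_coset hyu, hdy, map_zero]
        exact zero_mem _
      · rw [sub_add_cancel, sub_add_cancel, eq_sub_of_add_eq' hx']
        exact sub_mem hx.1 (T.part_mono _ (ray_add_subset c j) hy')
    · rintro ⟨y, hy, z, hz, rfl⟩
      refine ⟨y, T.part_mono _ ?_ hy.1, ?_, z, T.part_mono _ (Set.subset_univ _) hz.1, rfl⟩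
      · intro q hq
        have := T.le_of_mem_ray hq
        change j + 1 ≤ q
        omega
      · have := hZ _ hx
        rwa [map_add, T.d_d, add_zero] at this
  exact ⟨(Submodule.quotEquivOfEq _ _ hker.symm).trans (f.quotKerEquivOfSurjective hf)⟩

theorem spectralSequence_convergesTo :
    T.spectralSequence.ConvergesTo T.homology T.filtration :=
  ⟨T.filtration_antitone, fun _ => ⟨T.lo, T.filtration_eq_top le_rfl⟩,
    fun _ => ⟨T.hi + 1, T.filtration_eq_bot (lt_add_one _)⟩, T.hi - T.lo + 2, fun u hu hN =>
      ⟨T.page_d_eq_zero (by omega) hu, T.nonempty_page_equiv (by omega) hu⟩⟩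

end GradedPerturbation

end FilteredComplexes

namespace LinkDiagram

namespace Symmetry

/-! ### The total complex as a graded perturbation -/

variable {D : LinkDiagram} {G : Type*} [Group G] (σ : D.Symmetry G)

section Projection

variable (F : Type*) [Field F]

open scoped Classical in
/-- The projection of the complex to the quantum degrees in `J`. -/
def projCK (J : Set ℤ) : σ.CK F →ₗ[MonoidAlgebra F G] σ.CK F :=
  MonoidAlgebra.equivariantOfLinearOfComm
    (σ.coeff.symm.toLinearMap ∘ₗ
      LinearMap.pi (fun s => if s.qdeg ∈ J then LinearMap.proj s else 0) ∘ₗ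
      σ.coeff.toLinearMap)
    (fun g φ => by
      apply σ.coeff.injective
      simp only [LinearMap.comp_apply, LinearEquiv.coe_coe, coeff_smul,
        LinearEquiv.apply_symm_apply, Representation.asAlgebraHom_single, one_smul]
      funext s
      obtain ⟨s, rfl⟩ := (σ.statePerm g).surjective s
      change _ = σ.rep F g _ (σ.onState g s)
      rw [rep_apply]
      change (if (σ.onState g s).qdeg ∈ J then LinearMap.proj (σ.onState g s) else
        (0 : (D.EnhState → F) →ₗ[F] F)) (σ.rep F g (σ.coeff φ)) = _ *
          (if s.qdeg ∈ J then LinearMap.proj s else (0 : (D.EnhState → F) →ₗ[F] F)) (σ.coeff φ)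
      rw [qdeg_onState]
      split_ifs
      · exact σ.rep_apply F g _ s
      · simp)

variable {F}

open scoped Classical in
theorem coeff_projCK (J : Set ℤ) (φ : σ.CK F) (s : D.EnhState) :
    σ.coeff (σ.projCK F J φ) s = if s.qdeg ∈ J then σ.coeff φ s else 0 := by
  change (if s.qdeg ∈ J then LinearMap.proj s else
    (0 : (D.EnhState → F) →ₗ[F] F)) (σ.coeff φ) = _
  split_ifs <;> rfl

end Projection

variable {F : Type u} [Field F] {M : ModuleCat.{v} (MonoidAlgebra F G)}
  (P : ProjectiveResolution M)

/-- The projection of the total complex to the quantum degrees in `J`. -/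
def projTotal (J : Set ℤ) : σ.Total P →ₗ[F] σ.Total P where
  toFun f a := σ.projCK F J ∘ₗ σ.component P a f
  map_add' f f' := funext fun a => LinearMap.ext fun p =>
    map_add (σ.projCK F J) (σ.component P a f p) (σ.component P a f' p)
  map_smul' c f := funext fun a => LinearMap.ext fun p =>
    LinearMap.map_smul_of_tower (σ.projCK F J) c (σ.component P a f p)

open scoped Classical in
theorem coeff_projTotal (J : Set ℤ) (f : σ.Total P) (a : ℕ) (p : P.complex.X a)
    (s : D.EnhState) : σ.coeff (σ.component P a (σ.projTotal P J f) p) s =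
      if s.qdeg ∈ J then σ.coeff (σ.component P a f p) s else 0 :=
  σ.coeff_projCK J _ s

theorem total_ext {f f' : σ.Total P}
    (H : ∀ a p, σ.component P a f p = σ.component P a f' p) : f = f' :=
  funext fun a => LinearMap.ext fun p => H a p

theorem totalDiff_zero_apply (h t : F) (f : σ.Total P) (p : P.complex.X 0) :
    σ.component P 0 (σ.totalDiff P h t f) p = σ.diffCK h t (σ.component P 0 f p) := by
  change (-1 : F) ^ 0 • σ.diffCK h t (σ.component P 0 f p) + 0 = _
  rw [pow_zero, one_smul, add_zero]

theorem totalDiff_succ_apply (h t : F) (f : σ.Total P) (a : ℕ) (p : P.complex.X (a + 1)) :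
    σ.component P (a + 1) (σ.totalDiff P h t f) p =
      (-1 : F) ^ (a + 1) • σ.diffCK h t (σ.component P (a + 1) f p) +
        σ.component P a f ((P.complex.d (a + 1) a).hom p) := rfl

theorem totalDiff_totalDiff {h t : F} (H : ∀ φ : σ.CK F, σ.diffCK h t (σ.diffCK h t φ) = 0)
    (f : σ.Total P) : σ.totalDiff P h t (σ.totalDiff P h t f) = 0 := by
  have hlin : ∀ (c : F) (φ : σ.CK F), σ.diffCK h t (c • φ) = c • σ.diffCK h t φ := fun c φ =>
    LinearMap.map_smul_of_tower _ c φ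
  refine σ.total_ext P fun a p => ?_
  rw [map_zero, LinearMap.zero_apply]
  match a with
  | 0 => rw [totalDiff_zero_apply, totalDiff_zero_apply, H]
  | 1 =>
    rw [totalDiff_succ_apply, totalDiff_succ_apply, totalDiff_zero_apply, map_add, hlin, H]
    simp
  | a + 2 =>
    have hd : (P.complex.d (a + 1) a).hom ((P.complex.d (a + 2) (a + 1)).hom p) = 0 := by
      have := congrArg (fun g => g.hom p) (P.complex.d_comp_d (a + 2) (a + 1) a)
      exact this
    rw [totalDiff_succ_apply, totalDiff_succ_apply, totalDiff_succ_apply, map_add, hlin, H, hd,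
      map_zero, smul_zero, zero_add, add_zero, ← add_smul]
    rw [pow_succ _ (a + 1)]
    simp

theorem coeff_diffCK_apply (h t : F) (φ : σ.CK F) (s : D.EnhState) :
    σ.coeff (σ.diffCK h t φ) s = ∑ s', D.diffCoeff h t s' s * σ.coeff φ s' := rfl

theorem totalDiff_mem {i : ℤ} {J : Set ℤ} {f : σ.Total P} (hf : f ∈ σ.totalPart P i J) :
    σ.totalDiff P 0 0 f ∈ σ.totalPart P (i + 1) J := by
  have key : ∀ a p s, σ.coeff (σ.diffCK 0 0 (σ.component P a f p)) s ≠ 0 →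
      s.hdeg + a = i + 1 ∧ s.qdeg ∈ J := by
    intro a p s hs
    obtain ⟨s', -, hs'⟩ := Finset.exists_ne_zero_of_sum_ne_zero hs
    obtain ⟨h1, h2⟩ := hf a p s' (right_ne_zero_of_mul hs')
    rw [qdeg_of_diffCoeff_ne_zero (left_ne_zero_of_mul hs')]
    have := hdeg_of_diffCoeff_ne_zero (left_ne_zero_of_mul hs')
    exact ⟨by omega, h2⟩
  intro a p s hs
  match a with
  | 0 =>
    rw [totalDiff_zero_apply] at hs
    exact key 0 p s hs
  | a + 1 =>
    rw [totalDiff_succ_apply, map_add, map_smul, Pi.add_apply, Pi.smul_apply] at hs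
    by_cases h1 : σ.coeff (σ.diffCK 0 0 (σ.component P (a + 1) f p)) s = 0
    · rw [h1, smul_zero, zero_add] at hs
      obtain ⟨h2, h3⟩ := hf _ _ _ hs
      exact ⟨by push_cast; omega, h3⟩
    · exact key _ p s h1

theorem totalDiff_sub_mem {h t : F} {c : ℤ} (hc : h = 0 ∧ c = 4 ∨ t = 0 ∧ c = 2) {i : ℤ}
    {J : Set ℤ} {f : σ.Total P} (hf : f ∈ σ.totalPart P i J) :
    σ.totalDiff P h t f - σ.totalDiff P 0 0 f ∈ σ.totalPart P (i + 1) {q | q - c ∈ J} := by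
  intro a p s hs
  have hs' : σ.coeff (σ.diffCK h t (σ.component P a f p)) s ≠
      σ.coeff (σ.diffCK 0 0 (σ.component P a f p)) s := by
    intro H
    refine hs ?_
    rw [map_sub, LinearMap.sub_apply, map_sub, Pi.sub_apply, sub_eq_zero]
    match a with
    | 0 => rw [totalDiff_zero_apply, totalDiff_zero_apply, H]
    | a + 1 =>
      rw [totalDiff_succ_apply, totalDiff_succ_apply, map_add, map_add, map_smul, map_smul,
        Pi.add_apply, Pi.add_apply, Pi.smul_apply, Pi.smul_apply, H]
  rw [coeff_diffCK_apply, coeff_diffCK_apply, ← sub_ne_zero, ← Finset.sum_sub_distrib] at hs'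
  obtain ⟨s', -, hs'⟩ := Finset.exists_ne_zero_of_sum_ne_zero hs'
  rw [← sub_mul] at hs'
  have h1 := sub_ne_zero.1 (left_ne_zero_of_mul hs')
  obtain ⟨h2, h3⟩ := hf a p s' (right_ne_zero_of_mul hs')
  have h4 := hdeg_of_diffCoeff_ne h1
  refine ⟨by omega, ?_⟩
  change s.qdeg - c ∈ J
  rwa [qdeg_of_diffCoeff_ne hc h1, add_sub_cancel_right]

theorem abs_qdeg_le (s : D.EnhState) : |s.qdeg| ≤ ∑ s : D.EnhState, |s.qdeg| :=
  Finset.single_le_sum (f := fun s : D.EnhState => |s.qdeg|) (fun _ _ => abs_nonneg _)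
    (Finset.mem_univ s)

/-- The total complex with the perturbation of the Khovanov differential by the parameters `h` and
`t`. -/
def perturbation {h t : F} {c : ℤ} (hc : h = 0 ∧ c = 4 ∨ t = 0 ∧ c = 2)
    (H : ∀ φ : σ.CK F, σ.diffCK h t (σ.diffCK h t φ) = 0) :
    GradedPerturbation F (σ.Total P) c where
  part := σ.totalPart P
  proj := σ.projTotal P
  d₀ := σ.totalDiff P 0 0
  d := σ.totalDiff P h t
  lo := -∑ s : D.EnhState, |s.qdeg|
  hi := ∑ s : D.EnhState, |s.qdeg|
  c_pos := by rcases hc with ⟨-, rfl⟩ | ⟨-, rfl⟩ <;> norm_num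
  part_mono i J K hJK f hf a p s hs := ⟨(hf a p s hs).1, hJK (hf a p s hs).2⟩
  part_empty i := by
    rw [eq_bot_iff]
    intro f hf
    refine σ.total_ext P fun a p => σ.coeff.injective (funext fun s => ?_)
    by_contra hs
    exact (hf a p s fun h0 => hs (by rw [h0]; simp)).2
  part_bounds i J f hf a p s hs :=
    ⟨(hf a p s hs).1, (hf a p s hs).2, abs_le.1 (abs_qdeg_le s)⟩
  proj_mem K hf a p s hs := by
    classical
    rw [coeff_projTotal] at hs
    split_ifs at hs with h1
    · exact ⟨(hf a p s hs).1, (hf a p s hs).2, h1⟩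
    · exact absurd rfl hs
  sub_proj_mem K hf a p s hs := by
    classical
    rw [map_sub, LinearMap.sub_apply, map_sub, Pi.sub_apply, coeff_projTotal] at hs
    split_ifs at hs with h1
    · exact absurd (sub_self _) hs
    · rw [sub_zero] at hs
      exact ⟨(hf a p s hs).1, (hf a p s hs).2, h1⟩
  d₀_mem hf := σ.totalDiff_mem P hf
  d_sub_mem hf := σ.totalDiff_sub_mem P hc hf
  d_d := σ.totalDiff_totalDiff P H

/-- The differentials of Khovanov homology and of its deformation square to zero, and there is
a spectral sequence from the equivariant Khovanov homology to its deformation, if `X² - hX - t`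
has two different roots. -/
theorem exists_spectralSequence {h t : F} {c : ℤ} (hc : h = 0 ∧ c = 4 ∨ t = 0 ∧ c = 2)
    (r : Bool → F) (hsum : r true + r false = h) (hprod : r true * r false = -t)
    (hne : r true ≠ r false) :
    σ.diffCK (0 : F) 0 ∘ₗ σ.diffCK (0 : F) 0 = 0 ∧ σ.diffCK h t ∘ₗ σ.diffCK h t = 0 ∧
      ∃ E : BigradedSS.{max u v} F c,
        (∀ i j : ℤ, Nonempty ((E.page 1 le_rfl).X (i, j) ≃ₗ[F] σ.EKh P i j)) ∧
        E.ConvergesTo (σ.EK P h t) (σ.filtration P h t) := by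
  have hd : ∀ φ : D.EnhState → F, D.diff h t (D.diff h t φ) = 0 :=
    diff_diff_of_roots r hsum hprod hne
  have hd' : ∀ φ : σ.CK F, σ.diffCK h t (σ.diffCK h t φ) = 0 := fun φ =>
    σ.coeff.injective (by rw [coeff_diffCK, coeff_diffCK, hd, map_zero])
  refine ⟨LinearMap.ext fun φ => σ.coeff.injective ?_, LinearMap.ext hd',
    (σ.perturbation P hc hd').spectralSequence, (σ.perturbation P hc hd').nonempty_page_one_equiv,
    (σ.perturbation P hc hd').spectralSequence_convergesTo⟩
  rw [LinearMap.comp_apply, coeff_diffCK, coeff_diffCK, diff_zero_diff_zero hc hd,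
    LinearMap.zero_apply, map_zero]

end Symmetry

end LinkDiagram

end

theorem mainTheorem8 (F : Type u) [Field F] (m : ℕ) (hm : 1 < m)
    (D : LinkDiagram) (σ : D.Periodic m)
    (M : ModuleCat.{v} (MonoidAlgebra F (Multiplicative (ZMod m))))
    (P : ProjectiveResolution M) :
    (ringChar F ≠ 2 →
      σ.diffCK (0 : F) 0 ∘ₗ σ.diffCK (0 : F) 0 = 0 ∧
      σ.diffCK (0 : F) 1 ∘ₗ σ.diffCK (0 : F) 1 = 0 ∧
      ∃ E : BigradedSS.{max u v} F 4,
        (∀ i j : ℤ, Nonempty ((E.page 1 le_rfl).X (i, j) ≃ₗ[F] σ.EKh P i j)) ∧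
        E.ConvergesTo (σ.EK P 0 1) (σ.filtration P 0 1)) ∧
    (ringChar F = 2 →
      σ.diffCK (0 : F) 0 ∘ₗ σ.diffCK (0 : F) 0 = 0 ∧
      σ.diffCK (1 : F) 0 ∘ₗ σ.diffCK (1 : F) 0 = 0 ∧
      ∃ E : BigradedSS.{max u v} F 2,
        (∀ i j : ℤ, Nonempty ((E.page 1 le_rfl).X (i, j) ≃ₗ[F] σ.EKh P i j)) ∧
        E.ConvergesTo (σ.EK P 1 0) (σ.filtration P 1 0)) := by
  constructor
  · intro h2
    refine σ.exists_spectralSequence P (Or.inl ⟨rfl, rfl⟩) (fun b => if b then 1 else -1)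
      (by simp) (by simp) ?_
    have := Ring.two_ne_zero h2
    intro h
    simp only [if_true, Bool.false_eq_true, if_false] at h
    exact this (by linear_combination h)
  · intro _
    exact σ.exists_spectralSequence P (Or.inr ⟨rfl, rfl⟩) (fun b => if b then 1 else 0)
      (by simp) (by simp) (by simp)
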